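/- Let $N\subset M$ be an irreducible type III subfactor of finite index, i.e. $N\subset M$ are type III factors (von Neumann algebras on the same Hilbert space, with the same unit), $N'\cap M=\mathbb C1$, and the embedding $\iota:N\to M$ has a conjugate. Homomorphisms are unital $*$-homomorphisms, and $\mathrm{Hom}(\varphi_1,\varphi_2)=\{t\in B: t\varphi_1(a)=\varphi_2(a)t\ \forall a\in A\}$ for $\varphi_1,\varphi_2:A\to B$; $\varphi$ is irreducible if $\mathrm{Hom}(\varphi,\varphi)=\mathbb C1$. A homomorphism $\overline\varphi:B\to A$ is a conjugate of $\varphi:A\to B$ if there are $r\in\mathrm{Hom}(\mathrm{id}_A,\overline\varphi\varphi)$ and $\overline r\in\mathrm{Hom}(\mathrm{id}_B,\varphi\overline\varphi)$ with $\varphi(r^*)\overline r=1_B$, $\overline\varphi(\overline r^*)r=1_A$, normalized by $r^*r=d\,1_A$, $\overline r^*\overline r=d\,1_B$; $\dim_\varphi$ is the infimum of $d$ over all such solutions, and a solution with $d=\dim_\varphi$ is called standard. Let $\overline\iota:M\to N$ be a conjugate of $\iota$, $(w,v)$ a standard solution for $(\iota,\overline\iota)$, $\gamma=\iota\overline\iota$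 the canonical endomorphism of $M$, and $\mu(\cdot)=\dim_\iota^{-1}\,w^*\overline\iota(\cdot)w:M\to N$ the conditional expectation. Assume that $\gamma$ is multiplicity-free: $\gamma\simeq\bigoplus_{a\in I}\gamma_a$, $I$ finite, with $\gamma_a$ irreducible and pairwise (unitarily) inequivalent, implemented by isometries $s_a\in\mathrm{Hom}(\gamma_a,\gamma)$ with $\sum_a s_as_a^*=1$. Put $$h_a=\Big(\frac{\dim_\iota}{\dim_{\gamma_a}}\Big)^{1/2}s_a^*\,\iota(w),\qquad \phi_a(m)=h_a^*\gamma_a(m)h_a\quad(m\in M).$$ (i) The maps $\phi_a:M\to M$ are unital and positive, they are $N$-linear, i.e. $\phi_a(n_1mn_2)=n_1\phi_a(m)n_2$ for $n_1,n_2\in N$, $m\in M$, and $\{m\in M:\phi_a(m)=m\ \forall a\}=N$. (ii) The $\phi_a$ form a finite hypergroup $K_{N\subset M}$ in the sense of Sunder and Wildberger under composition: they are linearly independent, and $\phi_a\circ\phi_b=\sum_c\lambda_{ab}^c\,\phi_c$ with an associative product, $\lambda_{ab}^c\ge0$, $\sum_c\lambda_{ab}^c=1$, with $\phi_0=\mathrm{id}_M$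 for a certain index $0\in I$, and with an involution $a\mapsto\overline a$ of $I$, extending to an antiautomorphism ($\lambda_{\overline b\,\overline a}^{\overline c}=\lambda_{ab}^c$), such that $\lambda_{ab}^0\neq0$ if and only if $b=\overline a$. The coefficients are given as follows. Let $s_{ab}=s_a^*\gamma(s_b^*)\iota(w)\in\mathrm{Hom}(\gamma,\gamma_a\gamma_b)$. The space $\mathrm{Hom}(\gamma_c,\gamma_a\gamma_b)$ has a finite (possibly empty) basis $(t_i)$ with $t_i^*t_j=\delta_{ij}1$, and for every such basis there are numbers $\alpha_{ab}^{c,i}\in\mathbb C$ with $s_{ab}^*t_i=\alpha_{ab}^{c,i}\,s_c$, and $$\lambda_{ab}^c=\dim_\iota\cdot\frac{\dim_{\gamma_c}}{\dim_{\gamma_a}\dim_{\gamma_b}}\cdot\sum_i|\alpha_{ab}^{c,i}|^2 .$$ (iii) The Haar measure $\big(\sum_a\mu_a\big)^{-1}\sum_a\mu_a\phi_a$ of $K_{N\subset M}$, where $\mu_a=1/\lambda_{a\overline a}^0$ are the weights, equals $\iota\circ\mu$, and the weights are $\mu_a=\dim_{\gamma_a}$. -/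

import Mathlib

noncomputable section

namespace Subfactor

/-! ### Type III factors -/

section VonNeumann

variable {H : Type*} [NormedAddCommGroup H] [InnerProductSpace ℂ H] [CompleteSpace H]

/-- A von Neumann algebra is a factor if it is nonzero and its centre consists of the scalars. -/
structure IsFactor (M : VonNeumannAlgebra H) : Prop where
  nontrivial : Nontrivial H
  center : ∀ x ∈ M, x ∈ M.commutant → ∃ c : ℂ, x = c • 1

/-- A von Neumann algebra is of type III if each of its nonzero projections `p` is infinite, that
is, Murray-von Neumann equivalent in `M` to a proper subprojection of `p`. -/
def IsTypeIII (M : VonNeumannAlgebra H) : Prop :=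
  ∀ p ∈ M, IsStarProjection p → p ≠ 0 →
    ∃ v ∈ M, star v * v = p ∧ v * star v ≤ p ∧ v * star v ≠ p

/-- The embedding homomorphism of a von Neumann subalgebra `N ⊆ M`. -/
def embedding {N M : VonNeumannAlgebra H} (h : N ≤ M) :
    N.toStarSubalgebra →⋆ₐ[ℂ] M.toStarSubalgebra :=
  StarSubalgebra.inclusion (fun _ hx => h hx)

end VonNeumann

/-! ### Homomorphisms and intertwiners

Homomorphisms are unital `*`-homomorphisms; the composition of homomorphisms is the monoidal
product. Normality need not be demanded: a homomorphism between von Neumann algebras that has a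
conjugate over a normal one is normal. -/

section Intertwiners

variable {A B : Type*} [Ring A] [StarRing A] [Algebra ℂ A] [StarModule ℂ A]
  [Ring B] [StarRing B] [Algebra ℂ B] [StarModule ℂ B]

/-- The space `Hom(φ₁, φ₂)` of intertwiners. -/
def Hom (φ₁ φ₂ : A →⋆ₐ[ℂ] B) : Submodule ℂ B where
  carrier := {t | ∀ a, t * φ₁ a = φ₂ a * t}
  add_mem' := fun {s t} hs ht a => by rw [add_mul, mul_add, hs a, ht a]
  zero_mem' := fun a => by simp
  smul_mem' := fun c t ht a => by rw [smul_mul_assoc, mul_smul_comm, ht a]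

/-- `φ` is irreducible: `Hom(φ, φ) = ℂ 1`. -/
def IsIrreducibleHom (φ : A →⋆ₐ[ℂ] B) : Prop :=
  ∀ t ∈ Hom φ φ, ∃ c : ℂ, t = c • 1

/-- Unitary equivalence of homomorphisms. -/
def Equivalent (φ₁ φ₂ : A →⋆ₐ[ℂ] B) : Prop :=
  ∃ u ∈ Hom φ₁ φ₂, u ∈ unitary B

/-- `(r, r')` is a solution of the conjugacy relations for `φ : A → B` and `φ' : B → A`:
`r ∈ Hom(id_A, φ'φ)`, `r' ∈ Hom(id_B, φφ')`, `(1_φ × r*) ∘ (r' × 1_φ) = 1` and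
`(1_φ' × r'*) ∘ (r × 1_φ') = 1`, where the monoidal product of intertwiners is
`t₂ × t₁ = t₂ φ₂(t₁)`. The solution is normalized by `r* r = d 1_A` and `r'* r' = d 1_B`. -/
structure IsConjugateSolution (φ : A →⋆ₐ[ℂ] B) (φ' : B →⋆ₐ[ℂ] A) (r : A) (r' : B) (d : ℝ) :
    Prop where
  mem_left : r ∈ Hom (StarAlgHom.id ℂ A) (φ'.comp φ)
  mem_right : r' ∈ Hom (StarAlgHom.id ℂ B) (φ.comp φ')
  conj_left : φ (star r) * r' = 1
  conj_right : φ' (star r') * r = 1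
  norm_left : star r * r = (d : ℂ) • 1
  norm_right : star r' * r' = (d : ℂ) • 1

/-- The dimension of a homomorphism: the infimum of `d` over all conjugates and all normalized
solutions of the conjugacy relations. -/
def dimension (φ : A →⋆ₐ[ℂ] B) : ℝ :=
  sInf {d : ℝ | ∃ (φ' : B →⋆ₐ[ℂ] A) (r : A) (r' : B), IsConjugateSolution φ φ' r r' d}

/-- A standard solution of the conjugacy relations: one that saturates the infimum. -/
def IsStandardSolution (φ : A →⋆ₐ[ℂ] B) (φ' : B →⋆ₐ[ℂ] A) (r : A) (r' : B) : Prop :=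
  IsConjugateSolution φ φ' r r' (dimension φ)

/-- `γ ≅ ⊕ₐ γₐ` without multiplicities, implemented by isometries `sₐ ∈ Hom(γₐ, γ)`: the `γₐ` are
irreducible and pairwise inequivalent, and `∑ₐ sₐ sₐ* = 1`. -/
structure IsMultiplicityFreeDecomposition {I : Type*} [Fintype I]
    (γ : B →⋆ₐ[ℂ] B) (γs : I → B →⋆ₐ[ℂ] B) (s : I → B) : Prop where
  irreducible : ∀ a, IsIrreducibleHom (γs a)
  inequivalent : ∀ a b, a ≠ b → ¬ Equivalent (γs a) (γs b)
  mem : ∀ a, s a ∈ Hom (γs a) γ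
  isometry : ∀ a, star (s a) * s a = 1
  sum_eq_one : ∑ a, s a * star (s a) = 1

/-- `(tᵢ)` is an orthonormal basis of `Hom(φ₁, φ₂)` consisting of isometries:
`tᵢ* tⱼ = δᵢⱼ 1`. -/
structure IsOrthonormalBasis {n : ℕ} (φ₁ φ₂ : A →⋆ₐ[ℂ] B) (t : Fin n → B) : Prop where
  orthonormal : ∀ i j, star (t i) * t j = if i = j then 1 else 0
  span_eq : Submodule.span ℂ (Set.range t) = Hom φ₁ φ₂

/-- The linear map `m ↦ h* φ(m) h`. -/
def compress (φ : B →⋆ₐ[ℂ] B) (h : B) : Module.End ℂ B where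
  toFun m := star h * φ m * h
  map_add' m n := by rw [map_add, mul_add, add_mul]
  map_smul' c m := by simp

/-- `ι ∘ μ : B → B`, where `μ(m) = (dim ι)⁻¹ w* ι'(m) w` is the conditional expectation defined by
the conjugate `ι'` of `ι : A → B` and by `w ∈ Hom(id_A, ι'ι)`. -/
def condExp (ι : A →⋆ₐ[ℂ] B) (ι' : B →⋆ₐ[ℂ] A) (w : A) : Module.End ℂ B where
  toFun m := ι (((dimension ι : ℂ)⁻¹) • (star w * ι' m * w))
  map_add' m n := by rw [map_add, mul_add, add_mul, smul_add, map_add]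
  map_smul' c m := by
    simp only [map_smul, mul_smul_comm, smul_mul_assoc, RingHom.id_apply]
    rw [smul_comm]

/-- The element `h = (dim ι / dim γₐ)^(1/2) sₐ* ι(w)`. -/
def hElem (ι : A →⋆ₐ[ℂ] B) (w : A) (γa : B →⋆ₐ[ℂ] B) (sa : B) : B :=
  ((Real.sqrt (dimension ι / dimension γa) : ℝ) : ℂ) • (star sa * ι w)

/-- The map `φₐ(m) = hₐ* γₐ(m) hₐ`. -/
def phi (ι : A →⋆ₐ[ℂ] B) (w : A) (γa : B →⋆ₐ[ℂ] B) (sa : B) : Module.End ℂ B :=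
  compress γa (hElem ι w γa sa)

/-- The intertwiner `(sₐ* × s_b*) ∘ (1_ι × w × 1_ι') = sₐ* γ(s_b*) ι(w)` in `Hom(γ, γₐ γ_b)`, where
`γ = ι ι'`. -/
def sPair (ι : A →⋆ₐ[ℂ] B) (ι' : B →⋆ₐ[ℂ] A) (w : A) (sa sb : B) : B :=
  star sa * (ι.comp ι') (star sb) * ι w

end Intertwiners

/-! ### Hypergroups -/

/-- A finite hypergroup in the sense of Sunder and Wildberger with distinguished basis indexed by
`I`, given by the structure constants of `k i * k j = ∑ l, coeff i j l • k l`. The involution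
`bar` extends to an antiautomorphism of the hypergroup algebra. -/
structure FiniteHypergroup (I : Type*) [Fintype I] [DecidableEq I] where
  coeff : I → I → I → ℝ
  one : I
  bar : I → I
  coeff_nonneg : ∀ i j l, 0 ≤ coeff i j l
  sum_coeff : ∀ i j, ∑ l, coeff i j l = 1
  assoc : ∀ i j k l, ∑ m, coeff i j m * coeff m k l = ∑ m, coeff j k m * coeff i m l
  one_mul : ∀ j l, coeff one j l = if l = j then 1 else 0
  mul_one : ∀ i l, coeff i one l = if l = i then 1 else 0
  bar_bar : ∀ i, bar (bar i) = i
  bar_mul : ∀ i j l, coeff (bar j) (bar i) (bar l) = coeff i j l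
  coeff_one_ne_zero_iff : ∀ i j, coeff i j one ≠ 0 ↔ j = bar i

namespace FiniteHypergroup

variable {I : Type*} [Fintype I] [DecidableEq I]

/-- The weight of a basis element, the inverse of `coeff i (bar i) one`. -/
def weight (K : FiniteHypergroup I) (i : I) : ℝ := (K.coeff i (K.bar i) K.one)⁻¹

/-- The coefficients of the Haar measure `(∑ μᵢ)⁻¹ ∑ μᵢ kᵢ`. -/
def haar (K : FiniteHypergroup I) (i : I) : ℝ := (∑ j, K.weight j)⁻¹ * K.weight i

/-- The elements `k i` of an algebra form the hypergroup `K` under the multiplication of the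
algebra: they are a basis of their span, `k 1` is the unit, and they multiply with the structure
constants of `K`. -/
structure IsRealizedBy {R : Type*} [Ring R] [Algebra ℂ R] (K : FiniteHypergroup I) (k : I → R) :
    Prop where
  linearIndependent : LinearIndependent ℂ k
  one_eq : k K.one = 1
  mul_eq : ∀ i j, k i * k j = ∑ l, (K.coeff i j l : ℂ) • k l

end FiniteHypergroup

end Subfactor

end

open Subfactor

/-! Write `p_a = s_a s_a*` and suppress `ι`. Since `γ` is multiplicity-free, `Hom(γ,γ)` is the
commutative algebra with minimal projections `p_a` (`exists_coeff`). Besides composition it carries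
the convolution `T ∗ S = w* T γ(S) w`. The map `T ↦ (m ↦ w* γ(m) T w)` turns convolution into
composition of maps on `M` (`bimoduleMap_mul`), and it is injective because evaluation at `v v*`
gives back `T` (`bimoduleMap_apply_eq`). It sends `p_a` to `dim γ_a / dim ι` times `φ_a` (`phi_eq`).
The hypergroup is therefore convolution expressed in the basis `p_a`, and associativity comes for
free from composition.

Positivity and the coefficient formula come from `p_a ∗ p_b = s_ab* s_ab` (`star_sPair_mul_sPair`):
the coefficient at `p_c` is the squared norm of `s_ab s_c`, which Parseval's identity expands in a
basis of `Hom(γ_c, γ_a γ_b)` (`sum_norm_sq_eq`).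

The involution is rotation by `R = w v`, which makes `γ` selfconjugate. Rotation reverses
composition, hence permutes the `p_a` (`exists_bar`), and it reverses convolution
(`transpose_convolution`). Pairing `s_a` with its rotated partner solves the conjugacy relations, so
`γ_ā` is a conjugate of `γ_a` and `dim γ_a` is the trace of `p_a` (`exists_conjugates`). The unit is
the projection `v v* / dim ι` (`exists_unit`). Evaluating `v* (p_a ∗ p_b) v` as the trace of `p_a
p_b̄` shows that the unit occurs only for `b = ā`, with coefficient `1 / dim γ_a` in the hypergroup.

Finally `∑ p_a = 1` gives `∑ dim γ_a φ_a = (dim ι)² ι μ`, which yields the Haar measure and the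
common fixed points. -/

namespace Subfactor

set_option linter.unusedSectionVars false

open scoped ComplexOrder

/-! ### Intertwiner calculus, conjugates, Schur's lemma and dimensions. -/

section Basic

variable {A B C : Type*} [Ring A] [StarRing A] [Algebra ℂ A] [StarModule ℂ A]
  [Ring B] [StarRing B] [Algebra ℂ B] [StarModule ℂ B]
  [Ring C] [StarRing C] [Algebra ℂ C] [StarModule ℂ C]

/-- A `*`-algebra in which `x* x` is definite, in the weak sense needed for intertwiner
calculus. -/
class IsDefinite (B : Type*) [Ring B] [StarRing B] [Algebra ℂ B] : Prop where
  nonneg : ∀ (x : B) (c : ℂ), star x * x = c • 1 → 0 ≤ c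
  eq_zero : ∀ x : B, star x * x = 0 → x = 0

theorem Hom.star_mem {φ ψ : A →⋆ₐ[ℂ] B} {t : B} (ht : t ∈ Hom φ ψ) : star t ∈ Hom ψ φ := by
  intro a
  have := congrArg star (ht (star a))
  simpa [map_star] using this.symm

theorem Hom.mul_mem {φ ψ χ : A →⋆ₐ[ℂ] B} {t s : B} (ht : t ∈ Hom ψ χ) (hs : s ∈ Hom φ ψ) :
    t * s ∈ Hom φ χ := fun a => by
  rw [mul_assoc, hs a, ← mul_assoc, ht a, mul_assoc]

theorem Hom.one_mem (φ : A →⋆ₐ[ℂ] B) : (1 : B) ∈ Hom φ φ := fun a => by simp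

theorem Hom.comp_mem (χ : A →⋆ₐ[ℂ] B) {φ ψ : B →⋆ₐ[ℂ] C} {t : C} (ht : t ∈ Hom φ ψ) :
    t ∈ Hom (φ.comp χ) (ψ.comp χ) := fun a => ht (χ a)

namespace IsConjugateSolution

variable {φ : A →⋆ₐ[ℂ] B} {φ' : B →⋆ₐ[ℂ] A} {r : A} {r' : B} {d : ℝ}

theorem symm (h : IsConjugateSolution φ φ' r r' d) : IsConjugateSolution φ' φ r' r d :=
  ⟨h.mem_right, h.mem_left, h.conj_right, h.conj_left, h.norm_right, h.norm_left⟩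

theorem left_mul (h : IsConjugateSolution φ φ' r r' d) (a : A) : r * a = φ' (φ a) * r :=
  h.mem_left a

theorem right_mul (h : IsConjugateSolution φ φ' r r' d) (b : B) : r' * b = φ (φ' b) * r' :=
  h.mem_right b

theorem star_left_mul (h : IsConjugateSolution φ φ' r r' d) (a : A) :
    star r * φ' (φ a) = a * star r := Hom.star_mem h.mem_left a

theorem star_right_mul (h : IsConjugateSolution φ φ' r r' d) (b : B) :
    star r' * φ (φ' b) = b * star r' := Hom.star_mem h.mem_right b

theorem star_conj_left (h : IsConjugateSolution φ φ' r r' d) : star r' * φ r = 1 := by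
  have := congrArg star h.conj_left
  simpa [map_star] using this

theorem star_conj_right (h : IsConjugateSolution φ φ' r r' d) : star r * φ' r' = 1 :=
  h.symm.star_conj_left

/-- Nesting one solution inside the other. This makes `γ = ι ι'` selfconjugate and gives the
products `γ_a γ_b` conjugates. -/
theorem comp {ψ : B →⋆ₐ[ℂ] C} {ψ' : C →⋆ₐ[ℂ] B} {q : B} {q' : C} {e : ℝ}
    (h : IsConjugateSolution φ φ' r r' d) (k : IsConjugateSolution ψ ψ' q q' e) :
    IsConjugateSolution (ψ.comp φ) (φ'.comp ψ') (φ' q * r) (ψ r' * q') (d * e) where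
  mem_left a := by
    simp only [StarAlgHom.coe_id, id, StarAlgHom.comp_apply]
    rw [mul_assoc, h.left_mul, ← mul_assoc, ← map_mul, k.left_mul, map_mul, mul_assoc]
  mem_right a := by
    simp only [StarAlgHom.coe_id, id, StarAlgHom.comp_apply]
    rw [mul_assoc, k.right_mul, ← mul_assoc, ← map_mul, h.right_mul, map_mul, mul_assoc]
  conj_left := by
    simp only [StarAlgHom.comp_apply, star_mul, map_mul]
    rw [← map_star φ', mul_assoc, ← mul_assoc (ψ (φ (φ' (star q)))), ← map_mul, ← h.right_mul,
      map_mul, ← mul_assoc, ← mul_assoc, ← map_mul, h.conj_left, map_one, one_mul, k.conj_left]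
  conj_right := by
    simp only [StarAlgHom.comp_apply, star_mul, map_mul]
    rw [← map_star ψ, mul_assoc, ← mul_assoc (φ' (ψ' (ψ (star r')))), ← map_mul, ← k.left_mul,
      map_mul, ← mul_assoc, ← mul_assoc, ← map_mul, k.conj_right, map_one, one_mul, h.conj_right]
  norm_left := by
    rw [star_mul, mul_assoc, ← mul_assoc (star (φ' q)), ← map_star, ← map_mul, k.norm_left,
      map_smul, map_one, smul_one_mul, mul_smul_comm, h.norm_left, smul_smul]
    push_cast
    rw [mul_comm]
  norm_right := by
    rw [star_mul, mul_assoc, ← mul_assoc (star (ψ r')), ← map_star, ← map_mul, h.norm_right,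
      map_smul, map_one, smul_one_mul, mul_smul_comm, k.norm_right, smul_smul]
    push_cast
    rfl

/-- The conjugate of an irreducible homomorphism is irreducible. -/
theorem irreducible_conj (h : IsConjugateSolution φ φ' r r' d) (hφ : IsIrreducibleHom φ) :
    IsIrreducibleHom φ' := by
  intro t ht
  -- The rotation `t ↦ φ(r* t) r'` maps `Hom(φ', φ')` into `Hom(φ, φ)` and sends `1` to `1`. The
  -- rest shows that it is injective.
  obtain ⟨c, hc⟩ := hφ (φ (star r * t) * r') (fun a => by
    rw [mul_assoc, h.right_mul, ← mul_assoc, ← map_mul, mul_assoc, ht, ← mul_assoc,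
      h.star_left_mul, mul_assoc, map_mul, mul_assoc])
  refine ⟨c, ?_⟩
  have hz : t - c • 1 ∈ Hom φ' φ' := sub_mem ht (Submodule.smul_mem _ _ (Hom.one_mem _))
  have h0 : φ (star r * (t - c • 1)) * r' = 0 := by
    rw [mul_sub, map_sub, sub_mul, hc, mul_smul_comm, mul_one, map_smul, smul_mul_assoc,
      h.conj_left, sub_self]
  have h1 : star r * (t - c • 1) = 0 := by
    calc star r * (t - c • 1) = (star r * (t - c • 1)) * (star r * φ' r') := by
          rw [h.star_conj_right, mul_one]
      _ = star r * φ' (φ (star r * (t - c • 1)) * r') := by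
          rw [map_mul, ← mul_assoc, ← mul_assoc, h.star_left_mul]
      _ = 0 := by rw [h0, map_zero, mul_zero]
  have h2 : (t - c • 1) = (star r * φ' r') * (t - c • 1) := by
    rw [h.star_conj_right, one_mul]
  rw [mul_assoc, ← hz, ← mul_assoc, h1, zero_mul] at h2
  exact sub_eq_zero.mp h2

theorem pos [Nontrivial B] [IsDefinite B] (h : IsConjugateSolution φ φ' r r' d) : 0 < d := by
  have h0 := IsDefinite.nonneg _ _ h.norm_right
  refine lt_of_le_of_ne (by simpa using h0) ?_
  rintro rfl
  have h1 := h.norm_right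
  rw [Complex.ofReal_zero, zero_smul] at h1
  have h2 := h.conj_left
  rw [IsDefinite.eq_zero _ h1, mul_zero] at h2
  exact zero_ne_one h2

end IsConjugateSolution

theorem smul_one_inj [Nontrivial B] {a b : ℂ} (h : a • (1 : B) = b • 1) : a = b :=
  smul_left_injective ℂ one_ne_zero h

/-- A scalar multiple of a unitary, from an intertwiner between irreducible homomorphisms. -/
theorem exists_smul_of_irreducible [IsDefinite B] {φ ψ : A →⋆ₐ[ℂ] B} (hφ : IsIrreducibleHom φ)
    (hψ : IsIrreducibleHom ψ) {t : B} (ht : t ∈ Hom φ ψ) :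
    ∃ c : ℝ, 0 ≤ c ∧ star t * t = (c : ℂ) • 1 ∧ t * star t = (c : ℂ) • 1 := by
  obtain ⟨c, hc⟩ := hφ _ (Hom.mul_mem (Hom.star_mem ht) ht)
  obtain ⟨c', hc'⟩ := hψ _ (Hom.mul_mem ht (Hom.star_mem ht))
  obtain ⟨hre, him⟩ := Complex.nonneg_iff.mp (IsDefinite.nonneg _ _ hc)
  have hcr : ((c.re : ℝ) : ℂ) = c := Complex.ext rfl him
  refine ⟨c.re, hre, by rw [hcr, hc], ?_⟩
  rw [hcr]
  -- Evaluating `t t* t` in two ways forces the two scalars to agree unless `t = 0`.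
  have h1 : c • t = c' • t := by
    calc c • t = t * (star t * t) := by rw [hc, mul_smul_comm, mul_one]
      _ = c' • t := by rw [← mul_assoc, hc', smul_one_mul]
  by_cases h : c = c'
  · rw [hc', h]
  · have : t = 0 := by
      have h2 : (c - c') • t = 0 := by rw [sub_smul, h1, sub_self]
      exact (smul_eq_zero.mp h2).resolve_left (sub_ne_zero.mpr h)
    have h3 : c • (1 : B) = 0 := by rw [← hc, this, mul_zero]
    rw [h3, this, zero_mul]

/-- Schur's lemma: a nonzero intertwiner between irreducibles becomes unitary after rescaling. -/
theorem eq_zero_of_not_equivalent [IsDefinite B] {φ ψ : A →⋆ₐ[ℂ] B}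
    (hφ : IsIrreducibleHom φ) (hψ : IsIrreducibleHom ψ) (hne : ¬ Equivalent φ ψ) {t : B}
    (ht : t ∈ Hom φ ψ) : t = 0 := by
  obtain ⟨c, hc, h1, h2⟩ := exists_smul_of_irreducible hφ hψ ht
  rcases hc.eq_or_lt with rfl | hc
  · exact IsDefinite.eq_zero _ (by simpa using h1)
  · refine absurd ⟨((Real.sqrt c : ℝ) : ℂ)⁻¹ • t, Submodule.smul_mem _ _ ht, ?_⟩ hne
    have hs : (((Real.sqrt c : ℝ) : ℂ)⁻¹ * ((Real.sqrt c : ℝ) : ℂ)⁻¹) * (c : ℂ) = 1 := by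
      rw [← mul_inv, ← Complex.ofReal_mul, Real.mul_self_sqrt hc.le]
      exact inv_mul_cancel₀ (by exact_mod_cast hc.ne')
    rw [Unitary.mem_iff]
    constructor
    · rw [star_smul, smul_mul_smul_comm, h1, smul_smul, star_inv₀, Complex.star_def,
        Complex.conj_ofReal, hs, one_smul]
    · rw [star_smul, smul_mul_smul_comm, h2, smul_smul, star_inv₀, Complex.star_def,
        Complex.conj_ofReal, hs, one_smul]

/-- All normalized solutions for an irreducible homomorphism have the same parameter. -/
theorem IsConjugateSolution.unique [Nontrivial B] [Nontrivial A] [IsDefinite A] [IsDefinite B]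
    {φ : A →⋆ₐ[ℂ] B} (hφ : IsIrreducibleHom φ)
    {φ' φ'' : B →⋆ₐ[ℂ] A} {r q : A} {r' q' : B} {d e : ℝ}
    (h : IsConjugateSolution φ φ' r r' d) (k : IsConjugateSolution φ φ'' q q' e) : d = e := by
  -- This `u` compares the two conjugates: `q = u r` and `r' = φ(u*) q'`. As `u* u` and `u u*` are
  -- the same scalar `l`, taking norms gives `e = l d` and `d = l e`, hence `d = e`.
  have hu : φ'' (star r') * q ∈ Hom φ' φ'' := fun b => by
    rw [mul_assoc, k.left_mul, ← mul_assoc, ← map_mul, h.star_right_mul, map_mul, mul_assoc]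
  obtain ⟨l, hl, h1, h2⟩ := exists_smul_of_irreducible (h.irreducible_conj hφ)
    (k.irreducible_conj hφ) hu
  have hq : φ'' (star r') * q * r = q := by
    rw [mul_assoc, k.left_mul, ← mul_assoc, ← map_mul, h.star_conj_left, map_one, one_mul]
  have hr : φ (star (φ'' (star r') * q)) * q' = r' := by
    rw [star_mul, ← map_star φ'', star_star, map_mul, mul_assoc, ← k.right_mul, ← mul_assoc,
      k.conj_left, one_mul]
  have he : e = l * d := by
    have h3 := k.norm_left
    nth_rw 1 2 [← hq] at h3
    rw [star_mul, mul_assoc, ← mul_assoc (star (φ'' (star r') * q)), h1, smul_one_mul,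
      mul_smul_comm, h.norm_left, smul_smul] at h3
    exact_mod_cast (smul_one_inj h3).symm
  have hd : d = l * e := by
    have h3 := h.norm_right
    nth_rw 1 2 [← hr] at h3
    rw [star_mul, mul_assoc, ← map_star, star_star, ← mul_assoc (φ (φ'' (star r') * q)),
      ← map_mul, h2, map_smul, map_one, smul_one_mul,
      mul_smul_comm, k.norm_right, smul_smul] at h3
    exact_mod_cast (smul_one_inj h3).symm
  have hd0 := h.pos
  have he0 := k.pos
  nlinarith [mul_pos hd0 he0]

theorem IsConjugateSolution.dimension_eq [Nontrivial B] [Nontrivial A] [IsDefinite A]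
    [IsDefinite B] {φ : A →⋆ₐ[ℂ] B} (hφ : IsIrreducibleHom φ)
    {φ' : B →⋆ₐ[ℂ] A} {r : A} {r' : B} {d : ℝ}
    (h : IsConjugateSolution φ φ' r r' d) : dimension φ = d := by
  have : {e : ℝ | ∃ (φ' : B →⋆ₐ[ℂ] A) (r : A) (r' : B), IsConjugateSolution φ φ' r r' e} = {d} :=
    Set.eq_singleton_iff_unique_mem.mpr
      ⟨⟨φ', r, r', h⟩, fun e ⟨_, _, _, k⟩ => k.unique hφ h⟩
  rw [dimension, this, csInf_singleton]

/-- An orthonormal family of intertwiners into a homomorphism with a conjugate is bounded. -/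
theorem IsConjugateSolution.card_le [Nontrivial B] [IsDefinite B]
    (hB : IsIrreducibleHom (StarAlgHom.id ℂ B)) {χ ψ : A →⋆ₐ[ℂ] B} {ψ' : B →⋆ₐ[ℂ] A}
    {r : A} {r' : B} {d : ℝ} (h : IsConjugateSolution ψ ψ' r r' d) {n : ℕ} {t : Fin n → B}
    (ht : ∀ i, t i ∈ Hom χ ψ) (ho : ∀ i j, star (t i) * t j = if i = j then 1 else 0) :
    (n : ℝ) ≤ d * d := by
  have hd := h.pos
  have hd' : (d : ℂ) ≠ 0 := by exact_mod_cast hd.ne'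
  have hg : ∀ i, ∃ c : ℂ, star r' * (t i * star (t i)) * r' = c • 1 := fun i =>
    hB _ (Hom.mul_mem (Hom.mul_mem (Hom.star_mem h.mem_right)
      (Hom.comp_mem ψ' (Hom.mul_mem (ht i) (Hom.star_mem (ht i))))) h.mem_right)
  choose g hg using hg
  -- Cauchy–Schwarz for `t_i* r' t_i` and `χ(r)`, whose inner product is `1` and whose squared norms
  -- are `g_i` and `d`.
  have hlow : ∀ i, ((d⁻¹ : ℝ) : ℂ) ≤ g i := by
    intro i
    have hx : star (star (t i) * r') * (star (t i) * r') = g i • 1 := by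
      rw [star_mul, star_star, ← hg i]; noncomm_ring
    have hy : star (χ r) * χ r = (d : ℂ) • 1 := by
      rw [← map_star, ← map_mul, h.norm_left, map_smul, map_one]
    have hti : star (t i) * t i = 1 := by rw [ho, if_pos rfl]
    have hxy : star (χ r) * (star (t i) * r' * t i) = 1 := by
      rw [← map_star, ← mul_assoc, ← mul_assoc, ← Hom.star_mem (ht i), mul_assoc (star (t i)),
        h.conj_left, mul_one, hti]
    have hyx : star (star (t i) * r' * t i) * χ r = 1 := by
      simpa using congrArg star hxy
    have hxx : star (star (t i) * r' * t i) * (star (t i) * r' * t i) = g i • 1 := by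
      rw [star_mul, mul_assoc, ← mul_assoc (star (star (t i) * r')), hx, smul_one_mul,
        mul_smul_comm, hti]
    have hz : star (star (t i) * r' * t i - (d : ℂ)⁻¹ • χ r) *
        (star (t i) * r' * t i - (d : ℂ)⁻¹ • χ r) = (g i - (d : ℂ)⁻¹) • 1 := by
      rw [star_sub, star_smul, sub_mul, mul_sub, mul_sub, hxx, mul_smul_comm, hyx, smul_mul_assoc,
        hxy, smul_mul_smul_comm, hy, smul_smul, star_inv₀, Complex.star_def, Complex.conj_ofReal,
        mul_assoc, inv_mul_cancel₀ hd', mul_one, sub_self, sub_zero, sub_smul]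
    have := IsDefinite.nonneg _ _ hz
    rw [Complex.ofReal_inv]
    exact sub_nonneg.mp this
  -- Bessel's inequality for `r'` and the projection `e = ∑ t_i t_i*`.
  have hup : ∑ i, g i ≤ d := by
    set e := ∑ i, t i * star (t i) with he
    have hes : star e = e := by simp [he, star_sum]
    have het : ∀ j, e * t j = t j := by
      intro j
      rw [he, Finset.sum_mul]
      simp [mul_assoc, ho]
    have hee : e * e = e := by
      nth_rw 2 [he]
      rw [Finset.mul_sum]
      simp only [← mul_assoc, het]
      exact he.symm
    have hse : star r' * e * r' = (∑ i, g i) • 1 := by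
      rw [he, Finset.mul_sum, Finset.sum_mul, Finset.sum_smul]
      exact Finset.sum_congr rfl fun i _ => hg i
    have hz : star (r' - e * r') * (r' - e * r') = ((d : ℂ) - ∑ i, g i) • 1 := by
      rw [star_sub, star_mul, hes, sub_smul, ← h.norm_right, ← hse]
      calc _ = star r' * r' - star r' * e * r' - star r' * e * r' + star r' * (e * e) * r' := by
            noncomm_ring
        _ = _ := by rw [hee]; abel
    exact sub_nonneg.mp (IsDefinite.nonneg _ _ hz)
  have h1 : ∑ _i : Fin n, ((d⁻¹ : ℝ) : ℂ) ≤ d :=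
    (Finset.sum_le_sum fun i _ => hlow i).trans hup
  rw [Finset.sum_const, Finset.card_univ, Fintype.card_fin, nsmul_eq_mul] at h1
  have h2 : (n : ℝ) * d⁻¹ ≤ d := by exact_mod_cast h1
  rwa [← div_eq_mul_inv, div_le_iff₀ hd] at h2

/-- Intertwiner spaces from an irreducible homomorphism to one with a conjugate have a finite
orthonormal basis of isometries. -/
theorem IsConjugateSolution.exists_orthonormalBasis [Nontrivial B] [IsDefinite B]
    (hB : IsIrreducibleHom (StarAlgHom.id ℂ B)) {χ ψ : A →⋆ₐ[ℂ] B} (hχ : IsIrreducibleHom χ)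
    {ψ' : B →⋆ₐ[ℂ] A} {r : A} {r' : B} {d : ℝ} (h : IsConjugateSolution ψ ψ' r r' d) :
    ∃ (n : ℕ) (t : Fin n → B), IsOrthonormalBasis χ ψ t := by
  classical
  let P : ℕ → Prop := fun n => ∃ t : Fin n → B, (∀ i, t i ∈ Hom χ ψ) ∧
    ∀ i j, star (t i) * t j = if i = j then 1 else 0
  have hbd : ∀ n, P n → n ≤ ⌊d * d⌋₊ := fun n ⟨t, ht, ho⟩ => Nat.le_floor (h.card_le hB ht ho)
  have hP0 : P 0 := ⟨Fin.elim0, fun i => i.elim0, fun i => i.elim0⟩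
  -- A longest orthonormal family exists by the bound on its length. It spans: the Gram–Schmidt
  -- remainder `y` of any intertwiner has scalar `y* y`, so a nonzero `y` could be normalized and
  -- appended.
  obtain ⟨t, ht, ho⟩ := Nat.findGreatest_spec (P := P) (Nat.zero_le ⌊d * d⌋₊) hP0
  have hmax : ¬ P (Nat.findGreatest P ⌊d * d⌋₊ + 1) := fun hP =>
    absurd (Nat.le_findGreatest (hbd _ hP) hP) (by omega)
  generalize Nat.findGreatest P ⌊d * d⌋₊ = n at t ht ho hmax
  refine ⟨n, t, ho, le_antisymm (Submodule.span_le.mpr (by rintro _ ⟨i, rfl⟩; exact ht i)) ?_⟩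
  intro x hx
  have hxi : ∀ i, ∃ c : ℂ, star (t i) * x = c • 1 := fun i =>
    hχ _ (Hom.mul_mem (Hom.star_mem (ht i)) hx)
  choose c hc using hxi
  set y := x - ∑ i, c i • t i with hy
  have hyH : y ∈ Hom χ ψ :=
    sub_mem hx (Submodule.sum_mem _ fun i _ => Submodule.smul_mem _ _ (ht i))
  have hty : ∀ j, star (t j) * y = 0 := by
    intro j
    rw [hy, mul_sub, hc, Finset.mul_sum]
    simp [ho]
  have hyt : ∀ j, star y * t j = 0 := fun j => by simpa using congrArg star (hty j)
  obtain ⟨e, he⟩ := hχ _ (Hom.mul_mem (Hom.star_mem hyH) hyH)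
  obtain ⟨hre, him⟩ := Complex.nonneg_iff.mp (IsDefinite.nonneg _ _ he)
  have hcr : ((e.re : ℝ) : ℂ) = e := Complex.ext rfl him
  rcases hre.eq_or_lt with h0 | hpos
  · have : y = 0 := IsDefinite.eq_zero _ (by rw [he, ← hcr, ← h0]; simp)
    rw [this] at hy
    rw [sub_eq_zero.mp hy.symm]
    exact Submodule.sum_mem _ fun i _ =>
      Submodule.smul_mem _ _ (Submodule.subset_span ⟨i, rfl⟩)
  · refine absurd ⟨Fin.snoc t (((Real.sqrt e.re : ℝ) : ℂ)⁻¹ • y), ?_, ?_⟩ hmax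
    · intro i
      refine Fin.lastCases ?_ (fun i => ?_) i
      · simpa using Submodule.smul_mem _ _ hyH
      · simpa using ht i
    · have hs : (((Real.sqrt e.re : ℝ) : ℂ)⁻¹ * ((Real.sqrt e.re : ℝ) : ℂ)⁻¹) * e = 1 := by
        rw [← mul_inv, ← Complex.ofReal_mul, Real.mul_self_sqrt hpos.le, hcr]
        exact inv_mul_cancel₀ (by rw [← hcr]; exact_mod_cast hpos.ne')
      intro i j
      refine Fin.lastCases ?_ (fun i => ?_) i <;> refine Fin.lastCases ?_ (fun j => ?_) j
      · simp only [Fin.snoc_last, if_true]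
        rw [star_smul, smul_mul_smul_comm, he, smul_smul, star_inv₀, Complex.star_def,
          Complex.conj_ofReal, hs, one_smul]
      · simp [hyt, (Fin.castSucc_lt_last j).ne']
      · simp [hty, (Fin.castSucc_lt_last i).ne]
      · simp [ho]

end Basic

/-! ### The algebra of endomorphisms of a multiplicity-free homomorphism. -/

section Decomposition

variable {B : Type*} [Ring B] [StarRing B] [Algebra ℂ B] [StarModule ℂ B]
  {I : Type*} [Fintype I] {g : B →⋆ₐ[ℂ] B} {γs : I → B →⋆ₐ[ℂ] B} {s : I → B}

namespace IsMultiplicityFreeDecomposition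

theorem orthogonal [IsDefinite B] (hs : IsMultiplicityFreeDecomposition g γs s) {a b : I}
    (hab : a ≠ b) : star (s a) * s b = 0 :=
  eq_zero_of_not_equivalent (hs.irreducible b) (hs.irreducible a) (hs.inequivalent b a hab.symm)
    (Hom.mul_mem (Hom.star_mem (hs.mem a)) (hs.mem b))

theorem proj_mem (hs : IsMultiplicityFreeDecomposition g γs s) (a : I) :
    s a * star (s a) ∈ Hom g g := Hom.mul_mem (hs.mem a) (Hom.star_mem (hs.mem a))

theorem proj_mul_self (hs : IsMultiplicityFreeDecomposition g γs s) (a : I) :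
    s a * star (s a) * (s a * star (s a)) = s a * star (s a) := by
  rw [mul_assoc, ← mul_assoc (star (s a)), hs.isometry, one_mul]

theorem proj_mul_of_ne [IsDefinite B] (hs : IsMultiplicityFreeDecomposition g γs s) {a b : I}
    (hab : a ≠ b) : s a * star (s a) * (s b * star (s b)) = 0 := by
  rw [mul_assoc, ← mul_assoc (star (s a)), hs.orthogonal hab, zero_mul, mul_zero]

theorem proj_ne_zero [Nontrivial B] (hs : IsMultiplicityFreeDecomposition g γs s) (a : I) :
    s a * star (s a) ≠ 0 := fun h => by
  have h1 : star (s a) * (s a * star (s a)) * s a = 1 := by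
    rw [← mul_assoc, hs.isometry, one_mul, hs.isometry]
  rw [h, mul_zero, zero_mul] at h1
  exact zero_ne_one h1

theorem proj_smul_mul [IsDefinite B] (hs : IsMultiplicityFreeDecomposition g γs s) (x : I → ℂ)
    (b : I) :
    (∑ a, x a • (s a * star (s a))) * (s b * star (s b)) = x b • (s b * star (s b)) := by
  rw [Finset.sum_mul, Finset.sum_eq_single b]
  · rw [smul_mul_assoc, hs.proj_mul_self]
  · intro a _ hab
    rw [smul_mul_assoc, hs.proj_mul_of_ne hab, smul_zero]
  · simp

theorem coeff_eq [Nontrivial B] [IsDefinite B] (hs : IsMultiplicityFreeDecomposition g γs s)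
    {x y : I → ℂ} (h : ∑ a, x a • (s a * star (s a)) = ∑ a, y a • (s a * star (s a))) :
    x = y := by
  funext b
  have := congrArg (· * (s b * star (s b))) h
  simp only [hs.proj_smul_mul] at this
  exact smul_left_injective ℂ (hs.proj_ne_zero b) this

/-- The endomorphisms of a multiplicity-free homomorphism are the combinations of the minimal
projections. -/
theorem exists_coeff [IsDefinite B] (hs : IsMultiplicityFreeDecomposition g γs s)
    {T : B} (hT : T ∈ Hom g g) : ∃ x : I → ℂ, T = ∑ a, x a • (s a * star (s a)) := by
  have hx : ∀ a, ∃ c : ℂ, star (s a) * T * s a = c • 1 := fun a =>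
    hs.irreducible a _ (Hom.mul_mem (Hom.mul_mem (Hom.star_mem (hs.mem a)) hT) (hs.mem a))
  choose x hx using hx
  refine ⟨x, ?_⟩
  have hoff : ∀ a b, a ≠ b → star (s a) * T * s b = 0 := fun a b hab =>
    eq_zero_of_not_equivalent (hs.irreducible b) (hs.irreducible a) (hs.inequivalent b a hab.symm)
      (Hom.mul_mem (Hom.mul_mem (Hom.star_mem (hs.mem a)) hT) (hs.mem b))
  calc T = (∑ a, s a * star (s a)) * T * (∑ b, s b * star (s b)) := by
        rw [hs.sum_eq_one, one_mul, mul_one]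
    _ = ∑ a, ∑ b, s a * (star (s a) * T * s b) * star (s b) := by
        rw [Finset.sum_mul, Finset.sum_mul]
        refine Finset.sum_congr rfl fun a _ => ?_
        rw [Finset.mul_sum]
        exact Finset.sum_congr rfl fun b _ => by noncomm_ring
    _ = _ := by
        refine Finset.sum_congr rfl fun a _ => ?_
        rw [Finset.sum_eq_single a]
        · rw [hx, mul_smul_comm, mul_one, smul_mul_assoc]
        · intro b _ hba
          rw [hoff a b hba.symm, mul_zero, zero_mul]
        · simp

/-- By Schur's lemma only the component `c` of `γ` can receive `t`. This is the source of the
numbers `α` in the coefficient formula. -/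
theorem exists_smul [IsDefinite B] (hs : IsMultiplicityFreeDecomposition g γs s) {c : I}
    {t : B} (ht : t ∈ Hom (γs c) g) : ∃ α : ℂ, t = α • s c := by
  obtain ⟨α, hα⟩ := hs.irreducible c _ (Hom.mul_mem (Hom.star_mem (hs.mem c)) ht)
  refine ⟨α, ?_⟩
  calc t = ∑ a, s a * (star (s a) * t) := by
        simp only [← mul_assoc]; rw [← Finset.sum_mul, hs.sum_eq_one, one_mul]
    _ = s c * (star (s c) * t) := by
        refine Finset.sum_eq_single c (fun a _ hac => ?_) (by simp)
        rw [eq_zero_of_not_equivalent (hs.irreducible c) (hs.irreducible a)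
          (hs.inequivalent c a hac.symm) (Hom.mul_mem (Hom.star_mem (hs.mem a)) ht), mul_zero]
    _ = α • s c := by rw [hα, mul_smul_comm, mul_one]

end IsMultiplicityFreeDecomposition

end Decomposition

/-! ### Rotation of endomorphisms of a selfconjugate homomorphism. -/

section SelfConjugate

variable {B : Type*} [Ring B] [StarRing B] [Algebra ℂ B] [StarModule ℂ B]
  {g : B →⋆ₐ[ℂ] B} {R : B} {D : ℝ}

/-- The transpose `T ↦ (1 × R*) (1 × T × 1) (R × 1)` of an endomorphism of a selfconjugate
homomorphism `g`. -/
def transpose (g : B →⋆ₐ[ℂ] B) (R T : B) : B := g (star R * T) * R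

namespace IsConjugateSolution

variable (h : IsConjugateSolution g g R R D)
include h
variable {S T : B}

theorem transpose_mem (hT : T ∈ Hom g g) : transpose g R T ∈ Hom g g := fun a => by
  rw [transpose, mul_assoc, h.left_mul, ← mul_assoc, ← map_mul, mul_assoc, hT, ← mul_assoc,
    h.star_left_mul, mul_assoc, map_mul, mul_assoc]

/-- The characteristic property of the transpose: an endomorphism slides along the arc `R` from one
leg to the other. -/
theorem transpose_mul (hT : T ∈ Hom g g) : transpose g R T * R = g T * R := by
  rw [transpose, mul_assoc, h.left_mul, ← mul_assoc, ← map_mul, mul_assoc, hT, ← mul_assoc,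
    h.star_conj_right, one_mul]

/-- The conjugacy relation recovers `X` from `X R` as `g(R*) X R`, so identities between
endomorphisms may be checked on `R`. -/
theorem mul_right_cancel_mem (hS : S ∈ Hom g g) (hT : T ∈ Hom g g) (hST : S * R = T * R) :
    S = T := by
  have key : ∀ X ∈ Hom g g, X = g (star R) * (X * R) := fun X hX => by
    rw [← mul_assoc, ← hX, mul_assoc, h.conj_left, mul_one]
  rw [key S hS, key T hT, hST]

theorem eq_transpose (hS : S ∈ Hom g g) (hT : T ∈ Hom g g) (hST : S * R = g T * R) :
    S = transpose g R T :=
  h.mul_right_cancel_mem hS (h.transpose_mem hT) (by rw [h.transpose_mul hT, hST])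

theorem transpose_antimul (hS : S ∈ Hom g g) (hT : T ∈ Hom g g) :
    transpose g R (S * T) = transpose g R T * transpose g R S := by
  refine (h.eq_transpose (Hom.mul_mem (h.transpose_mem hT) (h.transpose_mem hS))
    (Hom.mul_mem hS hT) ?_).symm
  rw [mul_assoc, h.transpose_mul hS, ← mul_assoc, h.transpose_mem hT, mul_assoc,
    h.transpose_mul hT, ← mul_assoc, ← map_mul]

theorem transpose_ne_zero (hT : T ∈ Hom g g) (h0 : T ≠ 0) : transpose g R T ≠ 0 := fun hz => by
  have h1 : g T * R = 0 := by rw [← h.transpose_mul hT, hz, zero_mul]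
  apply h0
  calc T = T * star R * g R := by rw [mul_assoc, h.star_conj_right, mul_one]
    _ = star R * g (g T * R) := by rw [← h.star_left_mul, map_mul, mul_assoc]
    _ = 0 := by rw [h1, map_zero, mul_zero]

/-- Selfadjointness lets the sliding rule be used in adjoint form at `R*`, which undoes the first
rotation. -/
theorem transpose_transpose (hT : T ∈ Hom g g) (hsT : star T = T)
    (hsT' : star (transpose g R T) = transpose g R T) :
    transpose g R (transpose g R T) = T := by
  have h1 : star R * transpose g R T = star R * g T := by
    have := congrArg star (h.transpose_mul hT)
    rwa [star_mul, star_mul, hsT', ← map_star, hsT] at this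
  rw [transpose, h1, map_mul, mul_assoc, ← h.left_mul, ← mul_assoc, h.conj_left, one_mul]

end IsConjugateSolution

theorem transpose_mul_map_transpose (h : IsConjugateSolution g g R R D) {S T : B}
    (hS : S ∈ Hom g g) (hT : T ∈ Hom g g) :
    transpose g R S * g (transpose g R T) * (g R * R) = g (g (T * g S)) * (g R * R) := by
  have hS' : ∀ m, transpose g R S * g m = g m * transpose g R S := h.transpose_mem hS
  calc transpose g R S * g (transpose g R T) * (g R * R)
      = transpose g R S * g (g T * R) * R := by
        rw [← h.transpose_mul hT, map_mul]; simp only [mul_assoc]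
    _ = g (g T * R) * g S * R := by
        rw [hS', mul_assoc, h.transpose_mul hS, mul_assoc]
    _ = g (g (T * g S)) * (g R * R) := by
        rw [← map_mul, mul_assoc, h.left_mul, ← mul_assoc, ← map_mul, map_mul, mul_assoc]

/-- The transpose reverses products formed by means of a product `y : g g → g` and a coproduct
`z : g → g g` that are invariant under rotations. -/
theorem transpose_mul_comul (h : IsConjugateSolution g g R R D) {S T y z : B}
    (hS : S ∈ Hom g g) (hT : T ∈ Hom g g) (hy : ∀ m, y * g (g m) = g m * y)
    (hz : g z * R = z * R) (hyl : y * g R = z) (hyr : g y * R = z) :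
    y * transpose g R S * g (transpose g R T) * z * R = g (y * T * g S * z) * R := by
  have hS' : ∀ m, transpose g R S * g m = g m * transpose g R S := h.transpose_mem hS
  have hT' : ∀ m, transpose g R T * g m = g m * transpose g R T := h.transpose_mem hT
  have h3 := transpose_mul_map_transpose h hS hT
  have hzR : g (g y) * (g R * R) = z * R := by rw [← mul_assoc, ← map_mul, hyr, hz]
  generalize transpose g R S = S' at *
  generalize transpose g R T = T' at *
  calc y * S' * g T' * z * R = y * S' * (g T' * g (g y)) * (g R * R) := by
        rw [mul_assoc _ z, ← hzR]; simp only [mul_assoc]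
    _ = y * (S' * g (g y)) * g T' * (g R * R) := by
        rw [← map_mul, hT', map_mul]; simp only [mul_assoc]
    _ = y * g (g y) * (S' * g T' * (g R * R)) := by rw [hS']; simp only [mul_assoc]
    _ = y * g (g (y * T * g S)) * (g R * R) := by
        rw [h3, mul_assoc y T, map_mul g y, map_mul g (g y)]; simp only [mul_assoc]
    _ = g (y * T * g S) * (y * g R) * R := by rw [hy]; simp only [mul_assoc]
    _ = g (y * T * g S * z) * R := by
        rw [hyl, mul_assoc, ← hz, ← mul_assoc, ← map_mul]

/-- Compressing both legs of `R` to subobjects of `g` gives the candidate solution for a conjugate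
pair of components. -/
theorem pairing_mem {φ ψ : B →⋆ₐ[ℂ] B} (h : IsConjugateSolution g g R R D) {x y : B}
    (hx : x ∈ Hom φ g) (hy : y ∈ Hom ψ g) :
    star x * g (star y) * R ∈ Hom (StarAlgHom.id ℂ B) (φ.comp ψ) := fun m => by
  simp only [StarAlgHom.coe_id, id, StarAlgHom.comp_apply]
  rw [mul_assoc, h.left_mul, ← mul_assoc, mul_assoc (star x), ← map_mul, Hom.star_mem hy,
    map_mul, ← mul_assoc, Hom.star_mem hx]
  simp only [mul_assoc]

/-- Reduces the conjugacy relation of two components to the statement that the transpose of one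
projection is the other. -/
theorem map_star_pairing_mul_pairing {φ : B →⋆ₐ[ℂ] B} (h : IsConjugateSolution g g R R D)
    {x y : B} (hx : x ∈ Hom φ g) (hy : y * star y ∈ Hom g g) :
    φ (star (star y * g (star x) * R)) * (star x * g (star y) * R) =
      star x * transpose g R (y * star y) * x := by
  have hx' : ∀ m, star x * g m = φ m * star x := Hom.star_mem hx
  have hy' : ∀ m, y * star y * g m = g m * (y * star y) := hy
  calc φ (star (star y * g (star x) * R)) * (star x * g (star y) * R)
      = (φ (star R * g x * y) * star x) * g (star y) * R := by
        simp only [star_mul, star_star, ← map_star, mul_assoc]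
    _ = star x * g (star R * (g x * (y * star y))) * R := by
        rw [← hx', mul_assoc (star x), ← map_mul]; simp only [mul_assoc]
    _ = star x * g (star R * (y * star y)) * (g (g x) * R) := by
        rw [← hy', ← mul_assoc, map_mul g _ (g x)]; simp only [mul_assoc]
    _ = _ := by rw [← h.left_mul, transpose]; simp only [mul_assoc]

theorem star_pairing_mul_pairing {x y : B} (h : IsConjugateSolution g g R R D)
    (hx : x * star x ∈ Hom g g) (hy : y * star y ∈ Hom g g) :
    star (star x * g (star y) * R) * (star x * g (star y) * R) =
      star R * (x * star x * transpose g R (y * star y)) * R := by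
  have hx' : ∀ m, x * star x * g m = g m * (x * star x) := hx
  calc _ = star R * (g y * (x * star x)) * g (star y) * R := by
        simp only [star_mul, star_star, ← map_star, mul_assoc]
    _ = star R * (x * star x) * (g (y * star y) * R) := by
        rw [← hx', map_mul]; simp only [mul_assoc]
    _ = _ := by rw [← h.transpose_mul hy]; simp only [mul_assoc]

theorem transpose_sum_smul {I : Type*} [Fintype I] (x : I → ℂ) (p : I → B) :
    transpose g R (∑ a, x a • p a) = ∑ a, x a • transpose g R (p a) := by
  simp only [transpose, Finset.mul_sum, map_sum, Finset.sum_mul, mul_smul_comm, map_smul,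
    smul_mul_assoc]

/-- The transpose permutes the minimal projections of a multiplicity-free selfconjugate
homomorphism by an involution. -/
theorem IsMultiplicityFreeDecomposition.exists_bar [Nontrivial B] [IsDefinite B]
    {I : Type*} [Fintype I] {γs : I → B →⋆ₐ[ℂ] B} {s : I → B}
    (hs : IsMultiplicityFreeDecomposition g γs s) (h : IsConjugateSolution g g R R D) :
    ∃ bar : I → I, (∀ a, bar (bar a) = a) ∧
      ∀ a, transpose g R (s a * star (s a)) = s (bar a) * star (s (bar a)) := by
  have hcoef : ∀ b, ∃ x : I → ℂ, transpose g R (s b * star (s b)) =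
      ∑ a, x a • (s a * star (s a)) := fun b =>
    hs.exists_coeff (h.transpose_mem (hs.proj_mem b))
  choose k hk using hcoef
  have hne : ∀ b, ∃ a, k b a ≠ 0 := by
    intro b
    by_contra! hb
    exact h.transpose_ne_zero (hs.proj_mem b) (hs.proj_ne_zero b) (by simp [hk, hb])
  choose f hf using hne
  have hmul : ∀ b c a, (transpose g R (s b * star (s b)) * transpose g R (s c * star (s c))) *
      (s a * star (s a)) = (k b a * k c a) • (s a * star (s a)) := by
    intro b c a
    rw [mul_assoc, hk c, hs.proj_smul_mul, mul_smul_comm, hk b, hs.proj_smul_mul, smul_smul,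
      mul_comm]
  -- The transpose carries orthogonal idempotents to orthogonal idempotents, so the rows of the
  -- matrix `k` have entries `0` or `1` and disjoint supports. Being nonzero and as many as the
  -- columns, they form a permutation matrix.
  have horth : ∀ b c a, b ≠ c → k b a * k c a = 0 := by
    intro b c a hbc
    have := hmul b c a
    rw [← h.transpose_antimul (hs.proj_mem c) (hs.proj_mem b), hs.proj_mul_of_ne hbc.symm] at this
    simp only [transpose, mul_zero, map_zero, zero_mul] at this
    exact (smul_eq_zero.mp this.symm).resolve_right (hs.proj_ne_zero a)
  have hidem : ∀ b a, k b a * k b a = k b a := by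
    intro b a
    have := hmul b b a
    rw [← h.transpose_antimul (hs.proj_mem b) (hs.proj_mem b), hs.proj_mul_self, hk b,
      hs.proj_smul_mul] at this
    exact (smul_left_injective ℂ (hs.proj_ne_zero a) this).symm
  have hinj : Function.Injective f := by
    intro b c hbc
    by_contra hne
    have := horth b c (f b) hne
    rcases mul_eq_zero.mp this with h0 | h0
    · exact hf b h0
    · exact hf c (hbc ▸ h0)
  have hsurj := Finite.surjective_of_injective hinj
  have hT : ∀ b, transpose g R (s b * star (s b)) = s (f b) * star (s (f b)) := by
    intro b
    rw [hk, Finset.sum_eq_single (f b)]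
    · rw [(mul_eq_left₀ (hf b)).mp (hidem b (f b)), one_smul]
    · intro a _ hab
      obtain ⟨c, rfl⟩ := hsurj a
      have hcb : c ≠ b := fun hcb => hab (by rw [hcb])
      rw [(mul_eq_zero.mp (horth c b (f c) hcb)).resolve_left (hf c), zero_smul]
    · simp
  refine ⟨f, fun a => ?_, hT⟩
  have h2 : s (f (f a)) * star (s (f (f a))) = s a * star (s a) := by
    rw [← hT, ← hT, h.transpose_transpose (hs.proj_mem a) (by simp) (by rw [hT]; simp)]
  by_contra hne
  have := hs.proj_mul_of_ne hne
  rw [h2, hs.proj_mul_self] at this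
  exact hs.proj_ne_zero a this

end SelfConjugate

/-! ### Convolution on `Hom(γ, γ)`, its action on `M`, and the trace. -/

section Canonical

variable {A B : Type*} [Ring A] [StarRing A] [Algebra ℂ A] [StarModule ℂ A]
  [Ring B] [StarRing B] [Algebra ℂ B] [StarModule ℂ B]
  {ι : A →⋆ₐ[ℂ] B} {ι' : B →⋆ₐ[ℂ] A} {w : A} {v : B} {d : ℝ}

/-- The convolution product of endomorphisms of `γ = ι ι'`. -/
def convolution (ι : A →⋆ₐ[ℂ] B) (ι' : B →⋆ₐ[ℂ] A) (w : A) (T S : B) : B :=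
  ι (star w) * T * ι (ι' S) * ι w

/-- The map `m ↦ ι(w*) γ(m) T ι(w)` defined by an endomorphism `T` of `γ = ι ι'`. -/
def bimoduleMap (ι : A →⋆ₐ[ℂ] B) (ι' : B →⋆ₐ[ℂ] A) (w : A) : B →ₗ[ℂ] Module.End ℂ B :=
  LinearMap.mk₂ ℂ (fun T m => ι (star w) * ι (ι' m) * T * ι w)
    (fun _ _ _ => by noncomm_ring) (fun _ _ _ => by simp)
    (fun _ _ _ => by simp only [map_add]; noncomm_ring) (fun _ _ _ => by simp)

theorem bimoduleMap_apply (T m : B) :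
    bimoduleMap ι ι' w T m = ι (star w) * ι (ι' m) * T * ι w := rfl

namespace IsConjugateSolution

variable (h : IsConjugateSolution ι ι' w v d)
include h
variable {S T : B}

theorem canonical : IsConjugateSolution (ι.comp ι') (ι.comp ι') (ι w * v) (ι w * v) (d * d) :=
  h.symm.comp h

theorem map_left_mul (m : B) : ι w * ι (ι' m) = ι (ι' (ι (ι' m))) * ι w := by
  rw [← map_mul, h.left_mul, map_mul]

theorem map_star_left_mul (m : B) :
    ι (star w) * ι (ι' (ι (ι' m))) = ι (ι' m) * ι (star w) := by
  rw [← map_mul, h.star_left_mul, map_mul]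

theorem map_left_mul_left : ι w * ι w = ι (ι' (ι w)) * ι w := by
  rw [← map_mul, h.left_mul, map_mul]

theorem star_left_mul_star_left : ι (star w) * ι (ι' (ι (star w))) = ι (star w) * ι (star w) := by
  rw [← map_mul, h.star_left_mul, map_mul]

theorem map_conj_right : ι (star w) * ι (ι' v) = 1 := by
  rw [← map_mul, h.star_conj_right, map_one]

/-- The inner pair `w*`, `w`, sent through `γ`, is pulled outside by the intertwining property of
`w`, and `T` is moved past the image of `γ`. -/
theorem bimoduleMap_mul (hT : T ∈ Hom (ι.comp ι') (ι.comp ι')) :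
    bimoduleMap ι ι' w T * bimoduleMap ι ι' w S = bimoduleMap ι ι' w (convolution ι ι' w T S) := by
  have hT' : ∀ m, T * ι (ι' m) = ι (ι' m) * T := hT
  ext m
  simp only [Module.End.mul_apply, bimoduleMap_apply, convolution, map_mul]
  calc _ = (ι (star w) * ι (ι' (ι (star w)))) * ι (ι' (ι (ι' m))) * ι (ι' S) *
        (ι (ι' (ι w)) * T) * ι w := by noncomm_ring
    _ = ι (star w) * (ι (star w) * ι (ι' (ι (ι' m)))) * (ι (ι' S) * T) * (ι (ι' (ι w)) * ι w) := by
        rw [h.star_left_mul_star_left, ← hT']; noncomm_ring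
    _ = _ := by rw [h.map_star_left_mul, ← hT', ← h.map_left_mul_left]; noncomm_ring

/-- Each factor of `v v*` cancels one `w` by a conjugacy relation. Linear independence of the `φ_a`
rests on this. -/
theorem bimoduleMap_apply_eq (hT : T ∈ Hom (ι.comp ι') (ι.comp ι')) :
    bimoduleMap ι ι' w T (v * star v) = T := by
  have hT' : ∀ m, T * ι (ι' m) = ι (ι' m) * T := hT
  rw [bimoduleMap_apply, map_mul, map_mul, ← mul_assoc, h.map_conj_right, one_mul, ← hT',
    mul_assoc, ← map_mul, h.conj_right, map_one, mul_one]

theorem convolution_mem (hS : S ∈ Hom (ι.comp ι') (ι.comp ι'))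
    (hT : T ∈ Hom (ι.comp ι') (ι.comp ι')) :
    convolution ι ι' w T S ∈ Hom (ι.comp ι') (ι.comp ι') := by
  have hT' : ∀ m, T * ι (ι' m) = ι (ι' m) * T := hT
  have hS' : ∀ m, S * ι (ι' m) = ι (ι' m) * S := hS
  intro m
  simp only [StarAlgHom.comp_apply, convolution]
  rw [mul_assoc, h.map_left_mul, ← mul_assoc, mul_assoc _ (ι (ι' S)), ← map_mul, ← map_mul, hS',
    map_mul, map_mul, ← mul_assoc, mul_assoc _ T, hT', ← mul_assoc, h.map_star_left_mul]
  noncomm_ring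

/-- The two partial traces of an endomorphism of `γ = ι ι'` agree. -/
theorem exists_trace [Nontrivial A] [Nontrivial B] [IsDefinite A] [IsDefinite B]
    (hι : IsIrreducibleHom ι) (hT : T ∈ Hom (ι.comp ι') (ι.comp ι')) :
    ∃ c : ℂ, ι (star w) * T * ι w = c • 1 ∧
      star (ι w * v) * T * (ι w * v) = (d * c) • 1 ∧
      star (ι w * v) * ι (ι' T) * (ι w * v) = (d * c) • 1 := by
  have hT' : ∀ m, T * ι (ι' m) = ι (ι' m) * T := hT
  have hd : (d : ℂ) ≠ 0 := by exact_mod_cast h.pos.ne'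
  obtain ⟨c, hc⟩ := hι (ι (star w) * T * ι w) (fun a => by
    calc ι (star w) * T * ι w * ι a = ι (star w) * (T * ι (ι' (ι a))) * ι w := by
          rw [mul_assoc, ← map_mul, h.left_mul, map_mul]; noncomm_ring
      _ = ι (star w * ι' (ι a)) * T * ι w := by rw [hT', map_mul]; noncomm_ring
      _ = ι a * (ι (star w) * T * ι w) := by rw [h.star_left_mul, map_mul]; noncomm_ring)
  obtain ⟨c', hc'⟩ := h.irreducible_conj hι (star w * ι' T * w) (fun m => by
    calc star w * ι' T * w * ι' m = star w * (ι' (T * ι (ι' m))) * w := by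
          rw [mul_assoc, h.left_mul, map_mul]; noncomm_ring
      _ = star w * ι' (ι (ι' m)) * ι' T * w := by rw [hT', map_mul]; noncomm_ring
      _ = ι' m * (star w * ι' T * w) := by rw [h.star_left_mul]; noncomm_ring)
  -- Both `d c` and `d c'` are the value of `w* ι'(w* T w) w`: insert the inner scalar directly, or
  -- first move the outer `w` inside.
  have hcc : c = c' := by
    have h1 : (d * c) • (1 : A) = (d * c') • 1 := by
      calc (d * c) • (1 : A) = star w * ι' (ι (star w) * T * ι w) * w := by
            rw [hc, map_smul, map_one, mul_smul_comm, mul_one, smul_mul_assoc, h.norm_left,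
              smul_smul, mul_comm]
        _ = star w * ι' (ι (star w)) * ι' T * (ι' (ι w) * w) := by
            rw [map_mul, map_mul]; noncomm_ring
        _ = star w * (star w * ι' T * w) * w := by
            rw [h.star_left_mul, ← h.left_mul]; noncomm_ring
        _ = (d * c') • 1 := by
            rw [hc', mul_smul_comm, mul_one, smul_mul_assoc, h.norm_left, smul_smul, mul_comm]
    exact mul_left_cancel₀ hd (smul_one_inj h1)
  refine ⟨c, hc, ?_, ?_⟩
  · calc _ = star v * (ι (star w) * T * ι w) * v := by
          rw [star_mul, ← map_star]; noncomm_ring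
      _ = _ := by
          rw [hc, mul_smul_comm, mul_one, smul_mul_assoc, h.norm_right, smul_smul, mul_comm]
  · calc _ = star v * ι (star w * ι' T * w) * v := by
          rw [star_mul, ← map_star, map_mul, map_mul]; noncomm_ring
      _ = _ := by
          rw [hc', map_smul, map_one, mul_smul_comm, mul_one, smul_mul_assoc, h.norm_right,
            smul_smul, hcc, mul_comm]

/-- The transpose is an antiautomorphism of the convolution product. -/
theorem transpose_convolution (hS : S ∈ Hom (ι.comp ι') (ι.comp ι'))
    (hT : T ∈ Hom (ι.comp ι') (ι.comp ι')) :
    transpose (ι.comp ι') (ι w * v) (convolution ι ι' w T S) =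
      convolution ι ι' w (transpose (ι.comp ι') (ι w * v) S)
        (transpose (ι.comp ι') (ι w * v) T) := by
  have hc := h.canonical
  have hww : ι (w * star w) = ι w * ι (star w) := map_mul _ _ _
  refine (hc.eq_transpose (h.convolution_mem (hc.transpose_mem hT) (hc.transpose_mem hS))
    (h.convolution_mem hS hT) ?_).symm
  -- The product is `ι(w*) : γγ → γ` and the coproduct is `ι(w)`. Their rotation invariance follows
  -- from the conjugacy relations.
  refine transpose_mul_comul hc hS hT h.map_star_left_mul ?_ ?_ ?_
  · simp only [StarAlgHom.comp_apply]
    rw [← mul_assoc, ← h.map_left_mul_left, mul_assoc]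
  · simp only [StarAlgHom.comp_apply]
    rw [map_mul, map_mul, ← mul_assoc, ← map_mul, h.star_left_mul, hww, mul_assoc,
      h.map_conj_right, mul_one]
  · simp only [StarAlgHom.comp_apply]
    rw [← mul_assoc, ← map_mul, ← h.left_mul, hww, mul_assoc, h.conj_left, mul_one]

end IsConjugateSolution

end Canonical

/-! ### Conjugates, dimensions and the unit among the components of `γ`. -/

section Components

variable {A B : Type*} [Ring A] [StarRing A] [Algebra ℂ A] [StarModule ℂ A]
  [Ring B] [StarRing B] [Algebra ℂ B] [StarModule ℂ B]
  [Nontrivial A] [Nontrivial B] [IsDefinite A] [IsDefinite B]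
  {ι : A →⋆ₐ[ℂ] B} {ι' : B →⋆ₐ[ℂ] A} {w : A} {v : B} {d : ℝ}
  {I : Type*} [Fintype I] {γs : I → B →⋆ₐ[ℂ] B} {s : I → B}

/-- The components of `γ = ι ι'` have conjugates among the components; their dimensions are given
by the trace on the endomorphisms of `γ`. -/
theorem IsMultiplicityFreeDecomposition.exists_conjugates
    (hs : IsMultiplicityFreeDecomposition (ι.comp ι') γs s)
    (h : IsConjugateSolution ι ι' w v d) (hι : IsIrreducibleHom ι) :
    ∃ bar : I → I, (∀ a, bar (bar a) = a) ∧
      (∀ a, transpose (ι.comp ι') (ι w * v) (s a * star (s a)) =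
        s (bar a) * star (s (bar a))) ∧
      (∀ a, 0 < dimension (γs a)) ∧
      (∀ a, dimension (γs (bar a)) = dimension (γs a)) ∧
      (∀ a, ι (star w) * (s a * star (s a)) * ι w =
        ((dimension (γs a) / d : ℝ) : ℂ) • 1) ∧
      (∀ a, star (ι w * v) * (s a * star (s a)) * (ι w * v) = (dimension (γs a) : ℂ) • 1) ∧
      ∀ a, ∃ r r', IsConjugateSolution (γs a) (γs (bar a)) r r' (dimension (γs a)) := by
  have hc := h.canonical
  obtain ⟨bar, hbar, htr⟩ := hs.exists_bar hc
  have hd : (d : ℂ) ≠ 0 := by exact_mod_cast h.pos.ne'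
  have htrace := fun a => h.exists_trace hι (hs.proj_mem a)
  choose c hc1 hc2 hc3 using htrace
  have hreal : ∀ a, ((((d : ℂ) * c a).re : ℝ) : ℂ) = d * c a := by
    intro a
    have h1 : star (star (s a) * (ι w * v)) * (star (s a) * (ι w * v)) = ((d : ℂ) * c a) • 1 := by
      rw [← hc2, star_mul, star_star]; simp only [mul_assoc]
    exact Complex.ext rfl (Complex.nonneg_iff.mp (IsDefinite.nonneg _ _ h1)).2
  -- For an irreducible homomorphism every normalized solution has the same parameter, so this one
  -- already determines the dimension.
  have hconj : ∀ a, IsConjugateSolution (γs a) (γs (bar a))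
      (star (s (bar a)) * (ι.comp ι') (star (s a)) * (ι w * v))
      (star (s a) * (ι.comp ι') (star (s (bar a))) * (ι w * v)) ((d : ℂ) * c a).re := by
    intro a
    refine ⟨pairing_mem hc (hs.mem _) (hs.mem _), pairing_mem hc (hs.mem _) (hs.mem _), ?_, ?_, ?_,
      ?_⟩
    · rw [map_star_pairing_mul_pairing hc (hs.mem a) (hs.proj_mem _), htr, hbar, ← mul_assoc,
        hs.isometry, one_mul, hs.isometry]
    · rw [map_star_pairing_mul_pairing hc (hs.mem _) (hs.proj_mem _), htr, ← mul_assoc,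
        hs.isometry, one_mul, hs.isometry]
    · rw [star_pairing_mul_pairing hc (hs.proj_mem _) (hs.proj_mem _), htr, hs.proj_mul_self,
        hreal, ← hc3, mul_assoc, ← htr, hc.transpose_mul (hs.proj_mem a), ← mul_assoc]
      rfl
    · rw [star_pairing_mul_pairing hc (hs.proj_mem _) (hs.proj_mem _), htr, hbar,
        hs.proj_mul_self, hreal, ← hc2]
  have hdim : ∀ a, dimension (γs a) = ((d : ℂ) * c a).re := fun a =>
    (hconj a).dimension_eq (hs.irreducible a)
  have hdim' : ∀ a, (dimension (γs a) : ℂ) = d * c a := fun a => by rw [hdim, hreal]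
  have hsol : ∀ a, ∃ r r', IsConjugateSolution (γs a) (γs (bar a)) r r' (dimension (γs a)) :=
    fun a => ⟨_, _, by rw [hdim]; exact hconj a⟩
  refine ⟨bar, hbar, htr, ?_, ?_, ?_, ?_, hsol⟩
  · intro a
    obtain ⟨r, r', hr⟩ := hsol a
    exact hr.pos
  · intro a
    obtain ⟨r, r', hr⟩ := hsol a
    exact hr.symm.dimension_eq (hs.irreducible _)
  · intro a
    rw [Complex.ofReal_div, hdim', mul_div_cancel_left₀ _ hd, hc1]
  · intro a
    rw [hdim', hc2]

/-- The nonzero `v` has a nonzero component `s_z* v`. Two such components would link inequivalent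
`γ_a` and `γ_z` through the irreducible `id`, so `v` lies in the range of `s_z`. -/
theorem IsMultiplicityFreeDecomposition.exists_unit
    (hs : IsMultiplicityFreeDecomposition (ι.comp ι') γs s)
    (h : IsConjugateSolution ι ι' w v d) (hB : IsIrreducibleHom (StarAlgHom.id ℂ B)) :
    ∃ z : I, v * star v = (d : ℂ) • (s z * star (s z)) := by
  have hd : (d : ℂ) ≠ 0 := by exact_mod_cast h.pos.ne'
  have hu : ∀ a, star (s a) * v ∈ Hom (StarAlgHom.id ℂ B) (γs a) := fun a =>
    Hom.mul_mem (Hom.star_mem (hs.mem a)) h.mem_right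
  have hsum : v = ∑ a, s a * (star (s a) * v) := by
    simp only [← mul_assoc]
    rw [← Finset.sum_mul, hs.sum_eq_one, one_mul]
  have hex : ∃ z, star (s z) * v ≠ 0 := by
    by_contra! hz
    have hv : v = 0 := by rw [hsum]; simp [hz]
    have := h.norm_right
    rw [hv, mul_zero] at this
    exact hd (smul_one_inj (B := B) (by rw [← this, zero_smul]))
  obtain ⟨z, hz⟩ := hex
  have hv : v = s z * (star (s z) * v) := by
    refine hsum.trans (Finset.sum_eq_single z (fun a _ haz => ?_) (by simp))
    · have h0 : star (s a) * v = 0 := by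
        by_contra ha
        refine haz ?_
        by_contra
        have hm : (star (s z) * v) * star (star (s a) * v) ∈ Hom (γs a) (γs z) :=
          Hom.mul_mem (hu z) (Hom.star_mem (hu a))
        have h1 := eq_zero_of_not_equivalent (hs.irreducible a) (hs.irreducible z)
          (hs.inequivalent a z haz) hm
        obtain ⟨c, _, hc1, hc2⟩ := exists_smul_of_irreducible hB (hs.irreducible a) (hu a)
        have h2 : (c : ℂ) • (star (s z) * v) = 0 := by
          calc (c : ℂ) • (star (s z) * v)
              = (star (s z) * v) * (star (star (s a) * v) * (star (s a) * v)) := by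
                rw [hc1, mul_smul_comm, mul_one]
            _ = 0 := by rw [← mul_assoc, h1, zero_mul]
        have hc0 := (smul_eq_zero.mp h2).resolve_right hz
        exact ha (IsDefinite.eq_zero _ (by rw [hc1, hc0, zero_smul]))
      rw [h0, mul_zero]
  obtain ⟨c, _, hc1, hc2⟩ := exists_smul_of_irreducible hB (hs.irreducible z) (hu z)
  have hcd : (c : ℂ) = d := by
    apply smul_one_inj (B := B)
    rw [← hc1, ← h.norm_right, star_mul, star_star, mul_assoc, ← hv]
  refine ⟨z, ?_⟩
  calc v * star v = s z * ((star (s z) * v) * star (star (s z) * v)) * star (s z) := by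
        nth_rw 1 2 [hv]
        rw [star_mul]
        simp only [mul_assoc]
    _ = _ := by rw [hc2, hcd, mul_smul_comm, mul_one, smul_mul_assoc]

end Components

/-! ### The maps `φ_a` and the intertwiners `s_ab` in terms of the projections `p_a`. -/

section Maps

variable {A B : Type*} [Ring A] [StarRing A] [Algebra ℂ A] [StarModule ℂ A]
  [Ring B] [StarRing B] [Algebra ℂ B] [StarModule ℂ B]
  {ι : A →⋆ₐ[ℂ] B} {ι' : B →⋆ₐ[ℂ] A} {w : A} {v : B} {d : ℝ} {φ ψ : B →⋆ₐ[ℂ] B} {x y : B}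

theorem phi_eq (hx : x ∈ Hom φ (ι.comp ι')) (hφ : 0 ≤ dimension ι / dimension φ) :
    phi ι w φ x =
      ((dimension ι / dimension φ : ℝ) : ℂ) • bimoduleMap ι ι' w (x * star x) := by
  have hx' : ∀ m, x * φ m = ι (ι' m) * x := hx
  ext m
  rw [LinearMap.smul_apply, bimoduleMap_apply]
  change star (hElem ι w φ x) * φ m * hElem ι w φ x = _
  rw [hElem, star_smul, smul_mul_assoc, smul_mul_smul_comm, Complex.star_def, Complex.conj_ofReal,
    ← Complex.ofReal_mul, Real.mul_self_sqrt hφ, star_mul, star_star, mul_assoc (star (ι w)), hx',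
    ← map_star]
  simp only [mul_assoc]

/-- This intertwining property is the whole reason for `N`-linearity. -/
theorem IsConjugateSolution.hElem_mem (h : IsConjugateSolution ι ι' w v d)
    (hx : x ∈ Hom φ (ι.comp ι')) : hElem ι w φ x ∈ Hom ι (φ.comp ι) := by
  refine Submodule.smul_mem _ _ fun n => ?_
  have hx' : ∀ m, star x * ι (ι' m) = φ m * star x := Hom.star_mem hx
  rw [mul_assoc, ← map_mul, h.left_mul, map_mul, ← mul_assoc, hx', mul_assoc]
  rfl

theorem IsConjugateSolution.phi_bimodule (h : IsConjugateSolution ι ι' w v d)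
    (hx : x ∈ Hom φ (ι.comp ι')) (n₁ n₂ : A) (m : B) :
    phi ι w φ x (ι n₁ * m * ι n₂) = ι n₁ * phi ι w φ x m * ι n₂ := by
  have hh : ∀ n, hElem ι w φ x * ι n = φ (ι n) * hElem ι w φ x := h.hElem_mem hx
  have hh' : ∀ n, star (hElem ι w φ x) * φ (ι n) = ι n * star (hElem ι w φ x) :=
    Hom.star_mem (h.hElem_mem hx)
  change star (hElem ι w φ x) * φ _ * hElem ι w φ x =
    ι n₁ * (star (hElem ι w φ x) * φ m * hElem ι w φ x) * ι n₂
  rw [map_mul, map_mul, ← mul_assoc, ← mul_assoc, hh', mul_assoc _ (φ (ι n₂)), ← hh]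
  simp only [mul_assoc]

theorem IsConjugateSolution.sPair_mem (h : IsConjugateSolution ι ι' w v d)
    (hx : x ∈ Hom φ (ι.comp ι')) (hy : y ∈ Hom ψ (ι.comp ι')) :
    sPair ι ι' w x y ∈ Hom (ι.comp ι') (φ.comp ψ) := fun m => by
  have hx' : ∀ m, star x * ι (ι' m) = φ m * star x := Hom.star_mem hx
  have hy' : ∀ m, star y * ι (ι' m) = ψ m * star y := Hom.star_mem hy
  simp only [StarAlgHom.comp_apply, sPair]
  rw [mul_assoc, h.map_left_mul, ← mul_assoc, mul_assoc (star x), ← map_mul, ← map_mul, hy',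
    map_mul, map_mul, ← mul_assoc, hx']
  simp only [mul_assoc]

/-- Exhibits the convolution of two projections as a positive element; nonnegativity and the
explicit form of the coefficients both follow from it. -/
theorem star_sPair_mul_sPair (hx : x * star x ∈ Hom (ι.comp ι') (ι.comp ι')) :
    star (sPair ι ι' w x y) * sPair ι ι' w x y =
      convolution ι ι' w (x * star x) (y * star y) := by
  have hx' : ∀ m, x * star x * ι (ι' m) = ι (ι' m) * (x * star x) := hx
  calc star (sPair ι ι' w x y) * sPair ι ι' w x y
      = ι (star w) * (ι (ι' y) * (x * star x)) * ι (ι' (star y)) * ι w := by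
        simp only [sPair, StarAlgHom.comp_apply, star_mul, star_star, ← map_star, mul_assoc]
    _ = _ := by rw [← hx', convolution, map_mul ι' y, map_mul ι]; simp only [mul_assoc]

theorem condExp_eq :
    condExp ι ι' w = ((dimension ι : ℂ)⁻¹) • bimoduleMap ι ι' w 1 := by
  ext m
  rw [LinearMap.smul_apply, bimoduleMap_apply, mul_one, ← map_mul, ← map_mul, ← map_smul]
  rfl

end Maps

/-- Elements of an algebra with structure constants as in a hypergroup form one, the algebraic
axioms being inherited from the algebra. -/
theorem FiniteHypergroup.exists_isRealizedBy {R : Type*} [Ring R] [Algebra ℂ R] {I : Type*}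
    [Fintype I] [DecidableEq I] {k : I → R} (hk : LinearIndependent ℂ k)
    (coeff : I → I → I → ℝ) (one : I) (bar : I → I) (hone : k one = 1)
    (hmul : ∀ i j, k i * k j = ∑ l, (coeff i j l : ℂ) • k l)
    (coeff_nonneg : ∀ i j l, 0 ≤ coeff i j l) (sum_coeff : ∀ i j, ∑ l, coeff i j l = 1)
    (bar_bar : ∀ i, bar (bar i) = i)
    (bar_mul : ∀ i j l, coeff (bar j) (bar i) (bar l) = coeff i j l)
    (coeff_one_ne_zero_iff : ∀ i j, coeff i j one ≠ 0 ↔ j = bar i) :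
    ∃ K : FiniteHypergroup I, K.coeff = coeff ∧ K.one = one ∧ K.bar = bar ∧ K.IsRealizedBy k := by
  have hinj : ∀ x y : I → ℂ, ∑ i, x i • k i = ∑ i, y i • k i → x = y := fun x y hxy =>
    funext fun i => sub_eq_zero.mp (Fintype.linearIndependent_iff.mp hk (x - y)
      (by simp only [Pi.sub_apply, sub_smul, Finset.sum_sub_distrib, hxy, sub_self]) i)
  have hsingle : ∀ j, k j = ∑ l, (if l = j then (1 : ℂ) else 0) • k l := fun j => by simp
  refine ⟨{ coeff := coeff, one := one, bar := bar, coeff_nonneg := coeff_nonneg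
            sum_coeff := sum_coeff, assoc := ?_, one_mul := ?_, mul_one := ?_, bar_bar := bar_bar
            bar_mul := bar_mul, coeff_one_ne_zero_iff := coeff_one_ne_zero_iff },
    rfl, rfl, rfl, hk, hone, hmul⟩
  · intro a b c l
    have h1 : k a * k b * k c =
        ∑ l, (∑ m, (coeff a b m : ℂ) * (coeff m c l : ℂ)) • k l := by
      simp only [hmul, Finset.sum_mul, smul_mul_assoc, Finset.smul_sum, smul_smul, Finset.sum_smul]
      exact Finset.sum_comm
    have h2 : k a * (k b * k c) =
        ∑ l, (∑ m, (coeff b c m : ℂ) * (coeff a m l : ℂ)) • k l := by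
      simp only [hmul, Finset.mul_sum, mul_smul_comm, Finset.smul_sum, smul_smul, Finset.sum_smul]
      exact Finset.sum_comm
    have := congrFun (hinj _ _ (h1.symm.trans ((mul_assoc _ _ _).trans h2))) l
    exact_mod_cast this
  · intro j l
    have h1 := hmul one j
    rw [hone, _root_.one_mul] at h1
    have := congrFun (hinj _ _ (h1.symm.trans (hsingle j))) l
    split_ifs at this ⊢ <;> exact_mod_cast this
  · intro i l
    have h1 := hmul i one
    rw [hone, _root_.mul_one] at h1
    have := congrFun (hinj _ _ (h1.symm.trans (hsingle i))) l
    split_ifs at this ⊢ <;> exact_mod_cast this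

/-! ### Structure constants, unit, involution and weights. -/

section Main

variable {A B : Type*} [Ring A] [StarRing A] [Algebra ℂ A] [StarModule ℂ A]
  [Ring B] [StarRing B] [Algebra ℂ B] [StarModule ℂ B]
  [Nontrivial A] [Nontrivial B] [IsDefinite A] [IsDefinite B]
  {ι : A →⋆ₐ[ℂ] B} {ι' : B →⋆ₐ[ℂ] A} {w : A} {v : B} {d : ℝ}
  {I : Type*} [Fintype I] {γs : I → B →⋆ₐ[ℂ] B} {s : I → B}

theorem IsMultiplicityFreeDecomposition.exists_convolution_coeff
    (hs : IsMultiplicityFreeDecomposition (ι.comp ι') γs s)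
    (h : IsConjugateSolution ι ι' w v d) :
    ∃ β : I → I → I → ℝ, (∀ a b c, 0 ≤ β a b c) ∧
      ∀ a b, convolution ι ι' w (s a * star (s a)) (s b * star (s b)) =
        ∑ c, (β a b c : ℂ) • (s c * star (s c)) := by
  have hex : ∀ a b, ∃ x : I → ℂ, convolution ι ι' w (s a * star (s a)) (s b * star (s b)) =
        ∑ c, x c • (s c * star (s c)) := fun a b =>
    hs.exists_coeff (h.convolution_mem (hs.proj_mem b) (hs.proj_mem a))
  choose x hx using hex
  have hpos : ∀ a b c, 0 ≤ x a b c := by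
    intro a b c
    apply IsDefinite.nonneg (sPair ι ι' w (s a) (s b) * s c)
    calc _ = star (s c) * ((star (sPair ι ι' w (s a) (s b)) * sPair ι ι' w (s a) (s b)) *
          (s c * star (s c))) * s c := by
          rw [star_mul]
          simp only [mul_assoc, hs.isometry, mul_one]
      _ = x a b c • 1 := by
          rw [star_sPair_mul_sPair (hs.proj_mem a), hx, hs.proj_smul_mul, mul_smul_comm,
            smul_mul_assoc, ← mul_assoc, hs.isometry, one_mul, hs.isometry]
  have hre : ∀ a b c, (((x a b c).re : ℝ) : ℂ) = x a b c := fun a b c =>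
    Complex.ext rfl (Complex.nonneg_iff.mp (hpos a b c)).2
  exact ⟨fun a b c => (x a b c).re, fun a b c => (Complex.nonneg_iff.mp (hpos a b c)).1,
    fun a b => by simp only [hre, hx]⟩

/-- Parseval's identity for `s_ab s_c`: its squared norm is `β c`, and its coordinates in the basis
`t` are the conjugates of the `α i`. -/
theorem sum_norm_sq_eq (hs : IsMultiplicityFreeDecomposition (ι.comp ι') γs s)
    (h : IsConjugateSolution ι ι' w v d) {a b c : I} {β : I → ℝ}
    (hβ : convolution ι ι' w (s a * star (s a)) (s b * star (s b)) =
        ∑ c, (β c : ℂ) • (s c * star (s c)))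
    {n : ℕ} {t : Fin n → B} (ht : IsOrthonormalBasis (γs c) ((γs a).comp (γs b)) t) :
    ∃ α : Fin n → ℂ, (∀ i, star (sPair ι ι' w (s a) (s b)) * t i = α i • s c) ∧
      β c = ∑ i, ‖α i‖ ^ 2 := by
  set S := sPair ι ι' w (s a) (s b)
  have hS := h.sPair_mem (hs.mem a) (hs.mem b)
  have htm : ∀ i, t i ∈ Hom (γs c) ((γs a).comp (γs b)) := fun i => by
    rw [← ht.span_eq]; exact Submodule.subset_span ⟨i, rfl⟩
  have hα : ∀ i, ∃ α : ℂ, star S * t i = α • s c := fun i =>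
    hs.exists_smul (Hom.mul_mem (Hom.star_mem hS) (htm i))
  choose α hα using hα
  refine ⟨α, hα, ?_⟩
  have hx : S * s c ∈ Submodule.span ℂ (Set.range t) := by
    rw [ht.span_eq]; exact Hom.mul_mem hS (hs.mem c)
  obtain ⟨ξ, hξ⟩ := (Submodule.mem_span_range_iff_exists_fun ℂ).mp hx
  have hcoef : ∀ i, star (t i) * (S * s c) = ξ i • 1 := fun i => by
    rw [← hξ, Finset.mul_sum]
    simp [ht.orthonormal]
  have hξα : ∀ i, ξ i = star (α i) := fun i => by
    apply smul_one_inj (B := B)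
    rw [← hcoef, ← mul_assoc]
    have := congrArg star (hα i)
    rw [star_mul, star_star, star_smul] at this
    rw [this, smul_mul_assoc, hs.isometry]
  have h1 : star (S * s c) * (S * s c) = (β c : ℂ) • 1 := by
    calc _ = star (s c) * ((star S * S) * (s c * star (s c))) * s c := by
          rw [star_mul]
          simp only [mul_assoc, hs.isometry, mul_one]
      _ = _ := by
          rw [star_sPair_mul_sPair (hs.proj_mem a), hβ, hs.proj_smul_mul, mul_smul_comm,
            smul_mul_assoc, ← mul_assoc, hs.isometry, one_mul, hs.isometry]
  have h2 : star (S * s c) * (S * s c) = (∑ i, star (ξ i) * ξ i) • 1 := by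
    nth_rw 1 [← hξ]
    rw [star_sum, Finset.sum_mul, Finset.sum_smul]
    exact Finset.sum_congr rfl fun i _ => by
      rw [star_smul, smul_mul_assoc, hcoef, smul_smul]
  have h3 := smul_one_inj (h1.symm.trans h2)
  have h4 : ∀ i, star (ξ i) * ξ i = ((‖α i‖ ^ 2 : ℝ) : ℂ) := fun i => by
    rw [hξα, star_star, Complex.star_def, Complex.mul_conj, Complex.normSq_eq_norm_sq]
  simp only [h4] at h3
  exact_mod_cast h3

/-- The hypergroup of an irreducible inclusion whose canonical endomorphism is multiplicity-free. -/
theorem exists_hypergroup [DecidableEq I] (hι : IsIrreducibleHom ι)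
    (hB : IsIrreducibleHom (StarAlgHom.id ℂ B)) (h : IsStandardSolution ι ι' w v)
    (hs : IsMultiplicityFreeDecomposition (ι.comp ι') γs s) :
    (∀ a, phi ι w (γs a) (s a) 1 = 1) ∧
    (∀ m, (∀ a, phi ι w (γs a) (s a) m = m) ↔ m ∈ Set.range ι) ∧
    ∃ K : FiniteHypergroup I,
      K.IsRealizedBy (fun a => phi ι w (γs a) (s a)) ∧
      (∀ a b c,
        (∃ (n : ℕ) (t : Fin n → B), IsOrthonormalBasis (γs c) ((γs a).comp (γs b)) t) ∧
        ∀ (n : ℕ) (t : Fin n → B),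
          IsOrthonormalBasis (γs c) ((γs a).comp (γs b)) t →
          ∃ α : Fin n → ℂ,
            (∀ i, star (sPair ι ι' w (s a) (s b)) * t i = α i • s c) ∧
            K.coeff a b c = dimension ι *
                (dimension (γs c) / (dimension (γs a) * dimension (γs b))) * ∑ i, ‖α i‖ ^ 2) ∧
      ∑ a, (K.haar a : ℂ) • phi ι w (γs a) (s a) = condExp ι ι' w ∧
      ∀ a, K.weight a = dimension (γs a) := by
  obtain ⟨bar, hbar, htr, hδ, hδbar, htrace, hnorm, hsol⟩ := hs.exists_conjugates h hι
  obtain ⟨z, hz⟩ := hs.exists_unit h hB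
  obtain ⟨β, hβ0, hβ⟩ := hs.exists_convolution_coeff h
  have hd : 0 < dimension ι := h.pos
  set d := dimension ι with hddef
  set δ : I → ℝ := fun a => dimension (γs a) with hδdef
  change ∀ a, 0 < δ a at hδ
  have hdC : (d : ℂ) ≠ 0 := by exact_mod_cast hd.ne'
  have hδC : ∀ a, (δ a : ℂ) ≠ 0 := fun a => by exact_mod_cast (hδ a).ne'
  have hphi : ∀ a, phi ι w (γs a) (s a) =
      ((d / δ a : ℝ) : ℂ) • bimoduleMap ι ι' w (s a * star (s a)) := fun a =>
    phi_eq (hs.mem a) (div_nonneg hd.le (hδ a).le)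
  have hphi1 : ∀ a, phi ι w (γs a) (s a) 1 = 1 := by
    intro a
    rw [hphi, LinearMap.smul_apply, bimoduleMap_apply, map_one, map_one, mul_one, htrace, smul_smul,
      ← Complex.ofReal_mul, div_mul_div_cancel₀ (hδ a).ne', div_self hd.ne', Complex.ofReal_one,
      one_smul]
  have hsum : ∑ a, (δ a : ℂ) • phi ι w (γs a) (s a) = (d : ℂ) • bimoduleMap ι ι' w 1 := by
    rw [← hs.sum_eq_one, map_sum, Finset.smul_sum]
    refine Finset.sum_congr rfl fun a _ => ?_
    rw [hphi, smul_smul, Complex.ofReal_div, mul_div_cancel₀ _ (hδC a)]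
  -- Evaluate the preceding identity at `1`, where each `φ_a` is unital and `w* w = d`.
  have hsumδ : ∑ a, δ a = d ^ 2 := by
    have h1 := LinearMap.congr_fun hsum 1
    simp only [LinearMap.sum_apply, LinearMap.smul_apply, hphi1, bimoduleMap_apply, map_one,
      mul_one] at h1
    rw [← Finset.sum_smul, ← map_mul, h.norm_left, map_smul, map_one, smul_smul] at h1
    have h2 := smul_one_inj h1
    rw [pow_two]
    exact_mod_cast h2
  have hfix : ∀ m, (∀ a, phi ι w (γs a) (s a) m = m) ↔ m ∈ Set.range ι := by
    intro m
    constructor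
    · intro hm
      -- A common fixed point is fixed by the weighted average, which is `ι ∘ μ`, so it lies in the
      -- range of `ι`.
      have h1 := LinearMap.congr_fun hsum m
      simp only [LinearMap.sum_apply, LinearMap.smul_apply, hm] at h1
      rw [← Finset.sum_smul, ← Complex.ofReal_sum, hsumδ, Complex.ofReal_pow, pow_two,
        ← smul_smul] at h1
      have h2 := smul_right_injective B hdC h1
      refine ⟨((d : ℂ)⁻¹) • (star w * ι' m * w), ?_⟩
      rw [map_smul, map_mul, map_mul, inv_smul_eq_iff₀ hdC]
      exact (h2.trans (by rw [bimoduleMap_apply, mul_one])).symm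
    · rintro ⟨n, rfl⟩ a
      have h1 := h.phi_bimodule (hs.mem a) n 1 1
      rwa [map_one, mul_one, mul_one, hphi1, mul_one, mul_one] at h1
  have hbasis : ∀ a b c, ∃ (n : ℕ) (t : Fin n → B),
      IsOrthonormalBasis (γs c) ((γs a).comp (γs b)) t := by
    intro a b c
    obtain ⟨_, _, ha⟩ := hsol a
    obtain ⟨_, _, hb⟩ := hsol b
    exact (hb.comp ha).exists_orthonormalBasis hB (hs.irreducible c)
  have hli : LinearIndependent ℂ (fun a => phi ι w (γs a) (s a)) := by
    rw [Fintype.linearIndependent_iff]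
    intro x hx a
    have hT : ∑ a, (x a * ((d / δ a : ℝ) : ℂ)) • (s a * star (s a)) =
        ∑ a, (0 : ℂ) • (s a * star (s a)) := by
      have hmem : ∑ a, (x a * ((d / δ a : ℝ) : ℂ)) • (s a * star (s a)) ∈
          Hom (ι.comp ι') (ι.comp ι') :=
        Submodule.sum_mem _ fun a _ => Submodule.smul_mem _ _ (hs.proj_mem a)
      rw [← h.bimoduleMap_apply_eq hmem, map_sum]
      simp only [map_smul, mul_smul, ← hphi, hx]
      simp
    have h1 := congrFun (hs.coeff_eq hT) a
    refine (mul_eq_zero.mp h1).resolve_right ?_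
    rw [Complex.ofReal_div]
    exact div_ne_zero hdC (hδC a)
  have hmul : ∀ a b, phi ι w (γs a) (s a) * phi ι w (γs b) (s b) =
      ∑ c, ((d * (δ c / (δ a * δ b)) * β a b c : ℝ) : ℂ) • phi ι w (γs c) (s c) := by
    intro a b
    rw [hphi a, hphi b, smul_mul_smul_comm, h.bimoduleMap_mul (hs.proj_mem a), hβ, map_sum,
      Finset.smul_sum]
    refine Finset.sum_congr rfl fun c _ => ?_
    rw [hphi c, map_smul, smul_smul, smul_smul]
    congr 1
    have := hδC a
    have := hδC b
    have := hδC c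
    push_cast
    field_simp
  -- With `d p_z = v v*`, the relation `γ(m) v = v m` and the conjugacy relations collapse `w* γ(m)
  -- v v* w` to `m`. Unitality of `φ_z` then forces `δ z = 1`.
  have hunit : phi ι w (γs z) (s z) = ((δ z : ℂ)⁻¹) • 1 := by
    ext m
    have h1 : ι (ι' m) * v = v * m := (h.right_mul m).symm
    have h2 : star v * ι w = 1 := h.star_conj_left
    rw [hphi, Complex.ofReal_div, div_eq_inv_mul, mul_smul, ← map_smul, ← hz, LinearMap.smul_apply,
      LinearMap.smul_apply, bimoduleMap_apply]
    congr 1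
    calc _ = ι (star w) * (ι (ι' m) * v) * (star v * ι w) := by simp only [mul_assoc]
      _ = _ := by rw [h1, h2, mul_one, ← mul_assoc, h.conj_left, one_mul]; rfl
  have hδz : δ z = 1 := by
    have h1 := hphi1 z
    rw [hunit] at h1
    have h2 : (δ z : ℂ)⁻¹ = 1 := smul_one_inj (B := B) (by rw [one_smul]; exact h1)
    exact_mod_cast inv_eq_one.mp h2
  have hone : phi ι w (γs z) (s z) = 1 := by rw [hunit, hδz]; simp
  -- Compute `v* (p_a ∗ p_b) v` twice. Since `v` lies in the range of `p_z`, it is `d β a b z`;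
  -- sliding `p_b` along `R = w v` turns it into `R* p_a p_b̄ R`, a trace of orthogonal or equal
  -- projections.
  have hβz : ∀ a b, β a b z = if b = bar a then δ a / d else 0 := by
    intro a b
    have h1 : star v * convolution ι ι' w (s a * star (s a)) (s b * star (s b)) * v =
        (β a b z * d : ℂ) • 1 := by
      have hv : v = (s z * star (s z)) * v := by
        have h2 : (d : ℂ) • v = (d : ℂ) • ((s z * star (s z)) * v) := by
          rw [← smul_mul_assoc, ← hz, mul_assoc, h.norm_right, mul_smul_comm, mul_one]
        exact smul_right_injective B hdC h2
      rw [hβ, mul_assoc]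
      nth_rw 2 [hv]
      rw [← mul_assoc (∑ c, _), hs.proj_smul_mul, smul_mul_assoc, ← hv, mul_smul_comm, h.norm_right,
        smul_smul]
    have h2 : star v * convolution ι ι' w (s a * star (s a)) (s b * star (s b)) * v =
        star (ι w * v) * (s a * star (s a) * (s (bar b) * star (s (bar b)))) * (ι w * v) := by
      calc _ = star (ι w * v) * (s a * star (s a)) *
            ((ι.comp ι') (s b * star (s b)) * (ι w * v)) := by
            simp only [convolution, StarAlgHom.comp_apply, star_mul (ι w), ← map_star, mul_assoc]
        _ = _ := by
            rw [← h.canonical.transpose_mul (hs.proj_mem b), htr]; simp only [mul_assoc]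
    by_cases hb : b = bar a
    · rw [hb, hbar, hs.proj_mul_self, hnorm] at h2
      rw [hb] at h1 ⊢
      have h3 := smul_one_inj (h1.symm.trans h2)
      rw [if_pos rfl, eq_div_iff hd.ne']
      exact_mod_cast h3
    · have hab : a ≠ bar b := fun hab => hb (by rw [hab, hbar])
      rw [hs.proj_mul_of_ne hab, mul_zero, zero_mul] at h2
      rw [if_neg hb]
      have h3 : (β a b z * d : ℂ) = 0 :=
        smul_one_inj (B := B) (by rw [← h1, h2, zero_smul])
      exact_mod_cast (mul_eq_zero.mp h3).resolve_right hdC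
  have hβbar : ∀ a b c, β (bar b) (bar a) (bar c) = β a b c := by
    intro a b c
    have h1 := h.transpose_convolution (hs.proj_mem b) (hs.proj_mem a)
    rw [htr, htr, hβ, hβ, transpose_sum_smul] at h1
    simp only [htr] at h1
    have h2 : ∑ c, (β a b c : ℂ) • (s (bar c) * star (s (bar c))) =
        ∑ c, (β a b (bar c) : ℂ) • (s c * star (s c)) := by
      have := (Function.Involutive.bijective hbar).sum_comp
        (fun c => (β a b (bar c) : ℂ) • (s c * star (s c)))
      simpa [hbar] using this
    have h3 := congrFun (hs.coeff_eq (h2.symm.trans h1)) (bar c)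
    simp only [hbar] at h3
    exact_mod_cast h3.symm
  have hcoeffz : ∀ a b, d * (δ z / (δ a * δ b)) * β a b z = if b = bar a then (δ a)⁻¹ else 0 := by
    intro a b
    rw [hβz]
    split_ifs with hb
    · have hδb : δ b = δ a := by rw [hb]; exact hδbar a
      have := (hδ a).ne'
      rw [hδz, hδb]
      field_simp
    · rw [mul_zero]
  obtain ⟨K, hKc, hK1, hKb, hK⟩ := FiniteHypergroup.exists_isRealizedBy hli
    (fun a b c => d * (δ c / (δ a * δ b)) * β a b c) z bar hone hmul
    (fun a b c => mul_nonneg (mul_nonneg hd.le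
      (div_nonneg (hδ c).le (mul_nonneg (hδ a).le (hδ b).le))) (hβ0 a b c))
    -- Coefficients sum to `1` because both sides of the product formula are unital.
    (fun a b => by
      have h1 := LinearMap.congr_fun (hmul a b) 1
      simp only [Module.End.mul_apply, LinearMap.sum_apply, LinearMap.smul_apply, hphi1] at h1
      rw [← Finset.sum_smul] at h1
      have h2 := smul_one_inj (B := B) ((one_smul ℂ (1 : B)).trans h1)
      exact_mod_cast h2.symm)
    hbar
    (fun a b c => by
      simp only [hβbar, hδdef, hδbar]
      rw [mul_comm (dimension (γs b))])
    (fun a b => by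
      simp only [hcoeffz]
      split_ifs with hb
      · simp [hb, (hδ a).ne']
      · simp [hb])
  have hweight : ∀ a, K.weight a = δ a := fun a => by
    simp only [FiniteHypergroup.weight, hKc, hK1, hKb, hcoeffz, if_true, inv_inv]
  refine ⟨hphi1, hfix, K, hK, fun a b c => ⟨hbasis a b c, fun n t ht => ?_⟩, ?_, hweight⟩
  · obtain ⟨α, hα, hsumα⟩ := sum_norm_sq_eq hs h (hβ a b) ht
    exact ⟨α, hα, by rw [hKc, ← hsumα]⟩
  · simp only [FiniteHypergroup.haar, hweight, hsumδ, Complex.ofReal_mul, mul_smul]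
    rw [← Finset.smul_sum, hsum, condExp_eq, ← hddef, smul_smul]
    congr 1
    push_cast
    field_simp

end Main

/-! ### Von Neumann algebras: definiteness and positivity. -/

section Operators

variable {H : Type*} [NormedAddCommGroup H] [InnerProductSpace ℂ H] [CompleteSpace H]

/-- At a nonzero vector `ξ`, the scalar is `‖xξ‖² / ‖ξ‖²`; definiteness is the C*-identity. -/
theorem isDefinite_of_nontrivial [Nontrivial H] (M : VonNeumannAlgebra H) :
    IsDefinite M.toStarSubalgebra where
  nonneg x c hx := by
    have h1 : star (x : H →L[ℂ] H) * x = c • 1 := congrArg Subtype.val hx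
    obtain ⟨ξ, hξ⟩ := exists_ne (0 : H)
    have h2 : inner ℂ ξ ((star (x : H →L[ℂ] H) * x) ξ) = c * inner ℂ ξ ξ := by
      rw [h1]; simp
    rw [mul_apply_eq_comp, ContinuousLinearMap.star_eq_adjoint,
      ContinuousLinearMap.adjoint_inner_right, inner_self_eq_norm_sq_to_K,
      inner_self_eq_norm_sq_to_K] at h2
    have h3 : c = ((‖(x : H →L[ℂ] H) ξ‖ ^ 2 / ‖ξ‖ ^ 2 : ℝ) : ℂ) := by
      have : (‖ξ‖ : ℂ) ≠ 0 := by exact_mod_cast norm_ne_zero_iff.mpr hξ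
      push_cast
      rw [eq_div_iff (pow_ne_zero 2 this)]
      exact h2.symm
    rw [h3]
    exact_mod_cast by positivity
  eq_zero x hx := by
    have h1 : star (x : H →L[ℂ] H) * x = 0 := congrArg Subtype.val hx
    exact Subtype.ext (CStarRing.star_mul_self_eq_zero_iff _ |>.mp h1)

instance [Nontrivial H] (M : VonNeumannAlgebra H) : Nontrivial M.toStarSubalgebra :=
  ⟨⟨0, 1, fun h => zero_ne_one (α := H →L[ℂ] H) (congrArg Subtype.val h)⟩⟩

theorem IsFactor.irreducible_id {M : VonNeumannAlgebra H} (hM : IsFactor M) :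
    IsIrreducibleHom (StarAlgHom.id ℂ M.toStarSubalgebra) := by
  intro t ht
  obtain ⟨c, hc⟩ := hM.center t t.2 (by
    rw [VonNeumannAlgebra.mem_commutant_iff]
    intro m hm
    exact (congrArg Subtype.val (ht ⟨m, hm⟩)).symm)
  exact ⟨c, Subtype.ext hc⟩

/-- A positive operator in a von Neumann algebra `M` is of the form `x* x` with `x ∈ M`. -/
theorem exists_star_mul_self_eq {M : VonNeumannAlgebra H} {m : M.toStarSubalgebra}
    (hm : 0 ≤ (m : H →L[ℂ] H)) : ∃ x : M.toStarSubalgebra, star x * x = m := by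
  have hmem : CFC.sqrt (m : H →L[ℂ] H) ∈ M := by
    -- By the bicommutant property it suffices that the square root commutes with everything that
    -- commutes with `m`, which holds by functional calculus.
    suffices CFC.sqrt (m : H →L[ℂ] H) ∈ M.commutant.commutant by
      rwa [M.commutant_commutant] at this
    rw [VonNeumannAlgebra.mem_commutant_iff]
    intro y hy
    rw [VonNeumannAlgebra.mem_commutant_iff] at hy
    have : Commute (m : H →L[ℂ] H) y := hy m m.2
    exact (this.cfcₙ_nnreal _).eq.symm
  refine ⟨⟨_, hmem⟩, Subtype.ext ?_⟩
  change star (CFC.sqrt (m : H →L[ℂ] H)) * CFC.sqrt (m : H →L[ℂ] H) = m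
  rw [(CFC.sqrt_nonneg (m : H →L[ℂ] H)).isSelfAdjoint.star_eq, CFC.sqrt_mul_sqrt_self _ hm]

theorem phi_nonneg {N M : VonNeumannAlgebra H} (ι : N.toStarSubalgebra →⋆ₐ[ℂ] M.toStarSubalgebra)
    (w : N.toStarSubalgebra) (φ : M.toStarSubalgebra →⋆ₐ[ℂ] M.toStarSubalgebra)
    (x : M.toStarSubalgebra) {m : M.toStarSubalgebra} (hm : 0 ≤ (m : H →L[ℂ] H)) :
    0 ≤ (phi ι w φ x m : H →L[ℂ] H) := by
  obtain ⟨y, rfl⟩ := exists_star_mul_self_eq hm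
  have h1 : phi ι w φ x (star y * y) =
      star (φ y * hElem ι w φ x) * (φ y * hElem ι w φ x) := by
    change star (hElem ι w φ x) * φ (star y * y) * hElem ι w φ x = _
    rw [star_mul, map_mul, map_star]
    simp only [mul_assoc]
  rw [h1]
  exact star_mul_self_nonneg (R := H →L[ℂ] H) _

end Operators

end Subfactor

theorem propositionp {H : Type*} [NormedAddCommGroup H] [InnerProductSpace ℂ H] [CompleteSpace H]
    (N M : VonNeumannAlgebra H) (hNM : N ≤ M)
    (hN : IsFactor N) (hM : IsFactor M) (hN3 : IsTypeIII N) (hM3 : IsTypeIII M)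
    -- irreducibility of the subfactor
    (hirr : IsIrreducibleHom (embedding hNM))
    -- finite index: the embedding `ι` has a conjugate `ι'`, with a standard solution `(w, v)`
    (ι' : M.toStarSubalgebra →⋆ₐ[ℂ] N.toStarSubalgebra)
    (w : N.toStarSubalgebra) (v : M.toStarSubalgebra)
    (hwv : IsStandardSolution (embedding hNM) ι' w v)
    -- the canonical endomorphism `γ = ι ι'` is multiplicity-free
    {I : Type*} [Fintype I] [DecidableEq I]
    (γs : I → M.toStarSubalgebra →⋆ₐ[ℂ] M.toStarSubalgebra) (s : I → M.toStarSubalgebra)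
    (hγ : IsMultiplicityFreeDecomposition ((embedding hNM).comp ι') γs s) :
    -- (i) the maps are unital, positive and `N`-linear, with common fixed points `N`
    (∀ a, phi (embedding hNM) w (γs a) (s a) 1 = 1) ∧
    (∀ a, ∀ m : M.toStarSubalgebra, 0 ≤ (m : H →L[ℂ] H) →
      0 ≤ (phi (embedding hNM) w (γs a) (s a) m : H →L[ℂ] H)) ∧
    (∀ a, ∀ (n₁ n₂ : N.toStarSubalgebra) (m : M.toStarSubalgebra),
      phi (embedding hNM) w (γs a) (s a) (embedding hNM n₁ * m * embedding hNM n₂) =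
        embedding hNM n₁ * phi (embedding hNM) w (γs a) (s a) m * embedding hNM n₂) ∧
    (∀ m : M.toStarSubalgebra,
      (∀ a, phi (embedding hNM) w (γs a) (s a) m = m) ↔ (m : H →L[ℂ] H) ∈ N) ∧
    -- (ii) they form a hypergroup under composition, with explicit coefficients
    ∃ K : FiniteHypergroup I,
      K.IsRealizedBy (fun a => phi (embedding hNM) w (γs a) (s a)) ∧
      (∀ a b c,
        (∃ (n : ℕ) (t : Fin n → M.toStarSubalgebra),
          IsOrthonormalBasis (γs c) ((γs a).comp (γs b)) t) ∧
        ∀ (n : ℕ) (t : Fin n → M.toStarSubalgebra),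
          IsOrthonormalBasis (γs c) ((γs a).comp (γs b)) t →
          ∃ α : Fin n → ℂ,
            (∀ i, star (sPair (embedding hNM) ι' w (s a) (s b)) * t i = α i • s c) ∧
            K.coeff a b c =
              dimension (embedding hNM) *
                (dimension (γs c) / (dimension (γs a) * dimension (γs b))) *
                ∑ i, ‖α i‖ ^ 2) ∧
      -- (iii) the Haar measure is `ι ∘ μ`, and the weights are the dimensions
      ∑ a, (K.haar a : ℂ) • phi (embedding hNM) w (γs a) (s a) =
        condExp (embedding hNM) ι' w ∧
      ∀ a, K.weight a = dimension (γs a) := by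
  have hnt : Nontrivial H := hN.nontrivial
  have hNd := isDefinite_of_nontrivial N
  have hMd := isDefinite_of_nontrivial M
  obtain ⟨h1, hfix, hK⟩ := exists_hypergroup hirr hM.irreducible_id hwv hγ
  refine ⟨h1, fun a m hm => phi_nonneg _ _ _ _ hm,
    fun a n₁ n₂ m => hwv.phi_bimodule (hγ.mem a) n₁ n₂ m, fun m => (hfix m).trans ?_, hK⟩
  constructor
  · rintro ⟨n, rfl⟩
    exact n.2
  · exact fun hm => ⟨⟨m, hm⟩, rfl⟩
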